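/- Consider a network of $K$ users and a destination $d$. For a transmitter $j$ and a receiver $m$ (a user $m\neq j$, or $m=d$) the fading gain is $H_{m,j}=A_{m,j}/d_{m,j}^{\gamma/2}$, where $d_{m,j}>0$ is the distance, $\gamma$ is the path-loss exponent and the $A_{m,j}$ are i.i.d. zero-mean, unit-variance, proper complex Gaussian random variables. Fix a user $k$, a set $\mathcal C_k$ of users other than $k$ that cooperate with it, and a rate $R_k>0$; put $\mathcal S_k=\{k\}\cup\mathcal C_k$ and $L_k=|\mathcal C_k|+1$. User $j$ has power $\overline P_j=\lambda_j\overline P_k$ with constants $\lambda_j>0$, $\lambda_k=1$. Write $C(x)=\log_2(1+x)$. *The simplified $L_k$-hop dynamic decode-and-forward (DDF) strategy.* Unit time is divided into $L_k$ slots of lengths $\Theta_{k,1},\dots,\Theta_{k,L_k}$. User $\pi_k(1)=k$ transmits from slot $1$ on and, for $2\le l\le L_k$, user $\pi_k(l)\in\mathcal C_k$ transmits from slot $l$ on. Let $\overline\Theta_{k,l}=1-\sum_{i<l}\Theta_{k,i}$. For $l<L_k$, user $\pi_k(l+1)$ is the user $j\in\mathcal C_k\setminus\{\pi_k(1),\dots,\pi_k(l)\}$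 that attains the inner minimum (ties, which have probability zero, are broken by a fixed labelling of the users) in $$\Theta_{k,l}=\min\Big\{\overline\Theta_{k,l},\ \min_{j\in\mathcal C_k\setminus\{\pi_k(1),\dots,\pi_k(l)\}}\ \frac{R_k}{C\big(\sum_{m=1}^{l}|A_{j,\pi_k(m)}|^2\,\overline P_{\pi_k(m)}/d_{j,\pi_k(m)}^{\gamma}\big)}\Big\},$$ that is, a listening user collects energy for decoding in the current slot only; and $\Theta_{k,L_k}=\overline\Theta_{k,L_k}$. The outage probability of user $k$ is $$P_o^{(k)}=\Pr\Big(\sum_{l=1}^{L_k}\Theta_{k,l}\,C\Big(\sum_{j=1}^{l}|H_{d,\pi_k(j)}|^2\,\frac{\overline P_{\pi_k(j)}}{\overline\Theta_{k,j}}\Big)<R_k\Big),$$ where slots of length $0$ contribute $0$. The outage probability of the $L_k\times1$ distributed MIMO channel is $$P_{o,L_k\times1}=\Pr\Big(C\Big(\sum_{j\in\mathcal S_k}|H_{d,j}|^2\,\overline P_j\Big)<R_k\Big).$$ **Claim.** 1. $P_{o,L_k\times1}\le P_o^{(k)}$ for every $\overline P_k>0$, and, as $\overline P_k\to\infty$,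 $$P_{o,L_k\times1}=\frac{(2^{R_k}-1)^{L_k}}{L_k!\,\overline P_k^{L_k}}\prod_{j\in\mathcal S_k}\frac{d_{d,j}^{\gamma}}{\lambda_j}+O\big(\overline P_k^{-L_k-1}\big).$$ 2. Let $\theta_1^*,\dots,\theta_{L_k}^*>0$ be any real numbers with $\sum_{l=1}^{L_k}\theta_l^*=1$, and put $\overline\theta_j^*=1-\sum_{i<j}\theta_i^*$. There are constants $M,P_0>0$, which do not depend on $\overline P_k$, such that for all $\overline P_k\ge P_0$ $$P_o^{(k)}\le\frac{(2^{R_k}-1)^{L_k}}{L_k!\,\overline P_k^{L_k}}\Big(\prod_{j\in\mathcal S_k}\frac{d_{d,j}^{\gamma}}{\lambda_j}\Big)\,[K_c+K_d]+M\,\overline P_k^{-L_k-1},$$ where $$K_c=\frac{(2^{R_k/\theta_{L_k}^*}-1)^{L_k}\prod_{j=1}^{L_k}\overline\theta_j^*}{(2^{R_k}-1)^{L_k}},\qquad K_d=\frac{(2^{R_k/\theta_1^*}-1)^{L_k}\,L_k!}{(2^{R_k}-1)^{L_k}}\prod_{j\in\mathcal C_k}\frac{d_{j,k}^{\gamma}}{d_{d,j}^{\gamma}/\lambda_j}.$$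 3. DDF achieves diversity $L_k$: $\displaystyle\lim_{\overline P_k\to\infty}\frac{-\log P_o^{(k)}}{\log\overline P_k}=L_k.$ -/

import Mathlib

open MeasureTheory ProbabilityTheory Filter Topology

noncomputable section

/-- The law of a zero-mean, unit-variance, proper complex Gaussian random variable: independent
real and imaginary parts, each of law `N(0, 1/2)`. -/
def stdComplexGaussian : Measure ℂ :=
  ((gaussianReal 0 (1 / 2)).prod (gaussianReal 0 (1 / 2))).map Complex.measurableEquivRealProd.symm

/-- The parameters of one user's cooperation problem in a network of `K` users.  A receiver is
either a user (`some j`) or the destination (`none`); `dist m j` is the distance from transmitter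
`j` to receiver `m`. -/
structure UserCoopNetwork (K : ℕ) where
  /-- distances -/
  dist : Option (Fin K) → Fin K → ℝ
  dist_pos : ∀ m j, m ≠ some j → 0 < dist m j
  /-- the path-loss exponent -/
  pathLoss : ℝ
  /-- the user whose message is transmitted -/
  source : Fin K
  /-- the set of users that cooperate with the source -/
  coop : Finset (Fin K)
  source_notMem : source ∉ coop
  /-- the transmission rate of the source, in bits per channel use -/
  rate : ℝ
  rate_pos : 0 < rate

/-- `A m j ω` is the fading coefficient from transmitter `j` to receiver `m`.  Over all links
(pairs with `m ≠ j`) the coefficients are i.i.d. zero-mean, unit-variance, proper complex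
Gaussian. -/
structure IsIIDComplexGaussianFading {K : ℕ} {Ω : Type*} [MeasurableSpace Ω]
    (A : Option (Fin K) → Fin K → Ω → ℂ) (μ : Measure Ω) : Prop where
  measurable : ∀ m j, m ≠ some j → Measurable (A m j)
  law : ∀ m j, m ≠ some j → μ.map (A m j) = stdComplexGaussian
  indep : iIndepFun
    (fun (e : {e : Option (Fin K) × Fin K // e.1 ≠ some e.2}) => A e.1.1 e.1.2) μ

/-- The Gaussian capacity function `C(x) = log₂ (1 + x)`. -/
def gaussCap (x : ℝ) : ℝ := Real.logb 2 (1 + x)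

namespace UserCoopNetwork

variable {K : ℕ}

/-- The number of hops: the number of cooperating users plus one. -/
def hops (N : UserCoopNetwork K) : ℕ := N.coop.card + 1

/-- The source together with its cooperating users. -/
def transmitters (N : UserCoopNetwork K) : Finset (Fin K) := insert N.source N.coop

/-- The fading gain `H = A / d ^ (γ / 2)` from transmitter `j` to receiver `m`, for a realization
`a` of the fading coefficients. -/
def fadingGain (N : UserCoopNetwork K) (a : Option (Fin K) → Fin K → ℂ)
    (m : Option (Fin K)) (j : Fin K) : ℂ :=
  a m j / ((N.dist m j ^ (N.pathLoss / 2) : ℝ) : ℂ)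

/-! ### The simplified multi-hop dynamic decode-and-forward strategy

Below, `pw j` is the power of user `j` and `a` a realization of the fading coefficients.
Slots are numbered from `0`. -/

/-- The fraction of time that user `j` needs to decode the message while exactly the users in `S`
transmit, collecting energy in that slot only (`⊤` if user `j` receives no energy). -/
def decodeFraction (N : UserCoopNetwork K) (pw : Fin K → ℝ) (a : Option (Fin K) → Fin K → ℂ)
    (S : Finset (Fin K)) (j : Fin K) : ENNReal :=
  ENNReal.ofReal N.rate /
    ENNReal.ofReal (gaussCap (∑ m ∈ S, ‖N.fadingGain a (some j) m‖ ^ 2 * pw m))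

/-- The first of the remaining cooperating users to decode while the users in `S` transmit
(the one with the smallest label, in case of a tie, which has probability zero; the source, if
every cooperating user is already in `S`, a case that is never used). -/
def nextUser (N : UserCoopNetwork K) (pw : Fin K → ℝ) (a : Option (Fin K) → Fin K → ℂ)
    (S : Finset (Fin K)) : Fin K :=
  ((N.coop \ S).filter (fun j => ∀ i ∈ N.coop \ S,
    N.decodeFraction pw a S j ≤ N.decodeFraction pw a S i)).min.untopD N.source

/-- The set of users that transmit in slot `l`, and the user that starts transmitting there. -/
def slotState (N : UserCoopNetwork K) (pw : Fin K → ℝ) (a : Option (Fin K) → Fin K → ℂ) :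
    ℕ → Finset (Fin K) × Fin K
  | 0 => ({N.source}, N.source)
  | l + 1 =>
      (insert (N.nextUser pw a (N.slotState pw a l).1) (N.slotState pw a l).1,
        N.nextUser pw a (N.slotState pw a l).1)

/-- The set of users that transmit in slot `l`. -/
def activeUsers (N : UserCoopNetwork K) (pw : Fin K → ℝ) (a : Option (Fin K) → Fin K → ℂ)
    (l : ℕ) : Finset (Fin K) := (N.slotState pw a l).1

/-- The user that starts transmitting in slot `l`. -/
def order (N : UserCoopNetwork K) (pw : Fin K → ℝ) (a : Option (Fin K) → Fin K → ℂ)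
    (l : ℕ) : Fin K := (N.slotState pw a l).2

/-- The length of slot `l` if a time `t` has elapsed before it: the slot ends when the first
listening cooperating user decodes, or when the time is used up.  When no user is left listening,
the infimum is `⊤` and the slot takes all the remaining time. -/
def slotLength (N : UserCoopNetwork K) (pw : Fin K → ℝ) (a : Option (Fin K) → Fin K → ℂ)
    (l : ℕ) (t : ℝ) : ℝ :=
  (min (ENNReal.ofReal (1 - t))
    ((N.coop \ N.activeUsers pw a l).inf (N.decodeFraction pw a (N.activeUsers pw a l)))).toReal

/-- The total length of the slots before slot `l`. -/
def elapsed (N : UserCoopNetwork K) (pw : Fin K → ℝ) (a : Option (Fin K) → Fin K → ℂ) : ℕ → ℝ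
  | 0 => 0
  | l + 1 => N.elapsed pw a l + N.slotLength pw a l (N.elapsed pw a l)

/-- The time fraction of slot `l`. -/
def fraction (N : UserCoopNetwork K) (pw : Fin K → ℝ) (a : Option (Fin K) → Fin K → ℂ)
    (l : ℕ) : ℝ := N.slotLength pw a l (N.elapsed pw a l)

/-- The total fraction of time from slot `l` on, for which the user that starts in slot `l`
transmits. -/
def remaining (N : UserCoopNetwork K) (pw : Fin K → ℝ) (a : Option (Fin K) → Fin K → ℂ)
    (l : ℕ) : ℝ := 1 - N.elapsed pw a l

/-- The mutual information per unit time at the destination in slot `l`; the power of each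
transmitting user is scaled by the inverse of the fraction of time for which it transmits.
(If that fraction is `0`, then slot `l` has length `0` too, and the value is irrelevant.) -/
def slotInfo (N : UserCoopNetwork K) (pw : Fin K → ℝ) (a : Option (Fin K) → Fin K → ℂ)
    (l : ℕ) : ℝ :=
  gaussCap (∑ i ∈ Finset.range (l + 1),
    ‖N.fadingGain a none (N.order pw a i)‖ ^ 2 * (pw (N.order pw a i) / N.remaining pw a i))

/-- The mutual information collected by the destination over all slots. -/
def ddfInfo (N : UserCoopNetwork K) (pw : Fin K → ℝ) (a : Option (Fin K) → Fin K → ℂ) : ℝ :=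
  ∑ l ∈ Finset.range N.hops, N.fraction pw a l * N.slotInfo pw a l

/-- The outage probability of the source under the simplified multi-hop dynamic
decode-and-forward strategy. -/
def ddfOutage (N : UserCoopNetwork K) {Ω : Type*} [MeasurableSpace Ω] (μ : Measure Ω)
    (A : Option (Fin K) → Fin K → Ω → ℂ) (pw : Fin K → ℝ) : ℝ :=
  μ.real {ω | N.ddfInfo pw (fun m j => A m j ω) < N.rate}

/-- The outage probability of the distributed MIMO channel whose transmit antennas are the source
and its cooperating users, and whose single receive antenna is the destination. -/
def mimoOutage (N : UserCoopNetwork K) {Ω : Type*} [MeasurableSpace Ω] (μ : Measure Ω)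
    (A : Option (Fin K) → Fin K → Ω → ℂ) (pw : Fin K → ℝ) : ℝ :=
  μ.real {ω | gaussCap (∑ j ∈ N.transmitters,
    ‖N.fadingGain (fun m j => A m j ω) none j‖ ^ 2 * pw j) < N.rate}

/-! ### The leading term and the constants of the upper bound -/

/-- The leading term of the MIMO outage probability, at source power `P` and power ratios `lam`. -/
def mimoLeadingTerm (N : UserCoopNetwork K) (lam : Fin K → ℝ) (P : ℝ) : ℝ :=
  ((2 : ℝ) ^ N.rate - 1) ^ N.hops / ((N.hops.factorial : ℝ) * P ^ N.hops) *
    ∏ j ∈ N.transmitters, N.dist none j ^ N.pathLoss / lam j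

/-- The constant `K_c`; `θ l` is the reference fraction of slot `l`. -/
def constC (N : UserCoopNetwork K) (θ : ℕ → ℝ) : ℝ :=
  ((2 : ℝ) ^ (N.rate / θ (N.hops - 1)) - 1) ^ N.hops *
      (∏ j ∈ Finset.range N.hops, (1 - ∑ i ∈ Finset.range j, θ i)) /
    ((2 : ℝ) ^ N.rate - 1) ^ N.hops

/-- The constant `K_d`; `θ l` is the reference fraction of slot `l`. -/
def constD (N : UserCoopNetwork K) (lam : Fin K → ℝ) (θ : ℕ → ℝ) : ℝ :=
  ((2 : ℝ) ^ (N.rate / θ 0) - 1) ^ N.hops * (N.hops.factorial : ℝ) /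
      ((2 : ℝ) ^ N.rate - 1) ^ N.hops *
    ∏ j ∈ N.coop,
      N.dist (some j) N.source ^ N.pathLoss / (N.dist none j ^ N.pathLoss / lam j)

end UserCoopNetwork

end

/-! The squared moduli of the fading coefficients are independent exponential variables of rate one.
Their joint density is at most 1 and tends to 1 at the origin, so the probability that a weighted
sum of `n` of them stays below `t` is at most the volume `t ^ n / n! * ∏ (c j)⁻¹` of a simplex, and
at least that volume times `exp (-O(t))` (`measure_weightedSum_lt_le`, `le_measure_weightedSum_lt`).
With `t` of order `1 / P` this is the MIMO expansion. MIMO outage bounds DDF outage from below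
pointwise: by Jensen, averaging the received power over the slots can only increase the information,
and each user spends at most its power budget (`ddfInfo_le`).

For the upper bound the random slot lengths are compared with the reference fractions `θ`. If no
slot but the last exceeds its reference, the last one is at least as long as its reference, and
outage makes a weighted sum of destination gains small (`weightedSum_lt_of_fraction_le`). The
weights follow the random order of the users, but that order is a function of the inter-user links,
which are independent of the destination links, and the simplex bound is the same for every order
(`measure_weakSum_order_le`). This event contributes `constC`.

Otherwise some slot before the last, with `s` active users, is too long. Then every link from these
users to the `L - s` listeners is weak, and outage makes their links to the destination weak too
(`weak_links_of_lt_fraction`). These `s (L + 1 - s)` independent events each cost a factor `1 / P`,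
and `s (L + 1 - s) = L + (s - 1) (L - s)`. So `s = 1` contributes `constD` at leading order, while
`2 ≤ s < L` goes into the remainder. Diversity follows because both bounds are of order `P ^ (-L)`.
-/

noncomputable section

/-! ### Squared moduli of Gaussian variables and weighted sums of exponential variables -/

/-- The exponential law of rate one. -/
def unitExpLaw : Measure ℝ :=
  (volume.restrict (Set.Ioi 0)).withDensity (fun x => ENNReal.ofReal (Real.exp (-x)))

lemma lintegral_unitExpLaw {f : ℝ → ENNReal} (hf : Measurable f) :
    ∫⁻ x, f x ∂unitExpLaw = ∫⁻ x in Set.Ioi 0, ENNReal.ofReal (Real.exp (-x)) * f x := by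
  rw [unitExpLaw, lintegral_withDensity_eq_lintegral_mul _ (by fun_prop) hf]
  rfl

/-- Polar coordinates: the angle contributes `2π`, and the substitution `s = r ^ 2` turns `2π r dr`
into `π ds`. -/
lemma lintegral_normSq {f : ℝ → ENNReal} (hf : Measurable f) :
    ∫⁻ z : ℂ, f (‖z‖ ^ 2) = ENNReal.ofReal Real.pi * ∫⁻ s in Set.Ioi (0 : ℝ), f s := by
  have himage : (fun x : ℝ => x ^ 2) '' Set.Ioi 0 = Set.Ioi 0 := by
    ext y
    constructor
    · rintro ⟨x, hx, rfl⟩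
      exact pow_pos (Set.mem_Ioi.1 hx) 2
    · intro hy
      exact ⟨√y, Real.sqrt_pos.2 hy, Real.sq_sqrt (le_of_lt hy)⟩
  have hsub : ∫⁻ s in Set.Ioi (0 : ℝ), f s
      = ∫⁻ r in Set.Ioi (0 : ℝ), ENNReal.ofReal (2 * r) * f (r ^ 2) := by
    have h := lintegral_image_eq_lintegral_abs_deriv_mul (s := Set.Ioi (0 : ℝ))
      (f := fun x => x ^ 2) (f' := fun x => 2 * x) measurableSet_Ioi
      (fun x _ => by simpa using (hasDerivAt_pow 2 x).hasDerivWithinAt)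
      (fun x hx y hy h => (pow_left_inj₀ (le_of_lt hx) (le_of_lt hy) two_ne_zero).1 h) f
    rw [himage] at h
    rw [h]
    refine setLIntegral_congr_fun measurableSet_Ioi fun r hr => ?_
    have hr' : 0 < r := hr
    simp only [abs_of_pos (by positivity : (0 : ℝ) < 2 * r)]
  rw [← Complex.lintegral_comp_polarCoord_symm]
  have htarget : polarCoord.target = Set.Ioi (0 : ℝ) ×ˢ Set.Ioo (-Real.pi) Real.pi := rfl
  rw [htarget, Measure.volume_eq_prod, ← Measure.prod_restrict, lintegral_prod]
  · simp only [Complex.norm_polarCoord_symm, sq_abs, lintegral_const, Measure.restrict_apply_univ,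
      Real.volume_Ioo, smul_eq_mul]
    rw [hsub, lintegral_mul_const _ (by fun_prop), mul_comm,
      ← lintegral_const_mul _ (by fun_prop), ← lintegral_const_mul _ (by fun_prop)]
    refine setLIntegral_congr_fun measurableSet_Ioi fun r hr => ?_
    have hr' : 0 < r := hr
    rw [← mul_assoc, ← mul_assoc, ← ENNReal.ofReal_mul (by linarith [Real.pi_pos]),
      ← ENNReal.ofReal_mul Real.pi_pos.le]
    congr 2
    ring
  · simp only [Complex.norm_polarCoord_symm, sq_abs]
    fun_prop

lemma stdComplexGaussian_eq : stdComplexGaussian =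
    (volume : Measure ℂ).withDensity
      (fun z => ENNReal.ofReal (Real.pi⁻¹ * Real.exp (-‖z‖ ^ 2))) := by
  have hne : (1 / 2 : NNReal) ≠ 0 := by norm_num
  ext s hs
  rw [stdComplexGaussian, gaussianReal_of_var_ne_zero _ hne,
    prod_withDensity (by fun_prop) (by fun_prop), Measure.map_apply (by fun_prop) hs,
    withDensity_apply _ (Complex.measurableEquivRealProd.symm.measurable hs),
    withDensity_apply _ hs, ← Measure.volume_eq_prod,
    ← Complex.volume_preserving_equiv_real_prod.symm.setLIntegral_comp_preimage hs (by fun_prop)]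
  refine lintegral_congr fun p => ?_
  rw [gaussianPDF, gaussianPDF, ← ENNReal.ofReal_mul (gaussianPDFReal_nonneg _ _ _)]
  congr 1
  have hnorm : ‖Complex.measurableEquivRealProd.symm p‖ ^ 2 = p.1 ^ 2 + p.2 ^ 2 := by
    rw [← Complex.normSq_eq_norm_sq, Complex.normSq_apply]
    simp [Complex.measurableEquivRealProd]
    ring
  have hpi : √(2 * Real.pi * ((1 / 2 : NNReal) : ℝ)) = √Real.pi := by
    congr 1
    push_cast
    ring
  rw [gaussianPDFReal_def]
  simp only [sub_zero]
  rw [hpi, neg_eq_neg_one_mul, hnorm]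
  have : (√Real.pi)⁻¹ * (√Real.pi)⁻¹ = Real.pi⁻¹ := by
    rw [← mul_inv, Real.mul_self_sqrt Real.pi_pos.le]
  rw [mul_mul_mul_comm, this, ← Real.exp_add]
  congr 2
  push_cast
  ring

/-- The Gaussian density is radial, and its normalization `π⁻¹` cancels the `π` from polar
coordinates. -/
lemma map_normSq_stdComplexGaussian :
    stdComplexGaussian.map (fun z => ‖z‖ ^ 2) = unitExpLaw := by
  ext s hs
  rw [← lintegral_indicator_one hs, ← lintegral_indicator_one hs,
    lintegral_map (by fun_prop (disch := assumption)) (by fun_prop), stdComplexGaussian_eq,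
    lintegral_withDensity_eq_lintegral_mul _ (by fun_prop)
      (by exact (measurable_one.indicator hs).comp (by fun_prop)),
    lintegral_unitExpLaw (measurable_one.indicator hs)]
  have h := lintegral_normSq (f := fun x => ENNReal.ofReal (Real.pi⁻¹ * Real.exp (-x)) *
    s.indicator 1 x) (Measurable.mul (by fun_prop) (measurable_one.indicator hs))
  simp only [Pi.mul_apply]
  rw [h, ← lintegral_const_mul _
    (by exact Measurable.mul (by fun_prop) (measurable_one.indicator hs))]
  refine lintegral_congr fun x => ?_
  rw [← mul_assoc, ← ENNReal.ofReal_mul Real.pi_pos.le, ← mul_assoc,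
    mul_inv_cancel₀ Real.pi_pos.ne', one_mul]

/-- The volume of the standard simplex `{x ≥ 0, ∑ x < t}` in dimension `n` (at `n = 0`, the
indicator of `t > 0`). -/
def simplexVolume (n : ℕ) (t : ℝ) : ℝ := if 0 < t then t ^ n / n.factorial else 0

lemma simplexVolume_nonneg (n : ℕ) (t : ℝ) : 0 ≤ simplexVolume n t := by
  unfold simplexVolume
  split_ifs <;> positivity

@[fun_prop]
lemma measurable_simplexVolume (n : ℕ) : Measurable (simplexVolume n) :=
  Measurable.ite measurableSet_Ioi (by fun_prop) (by fun_prop)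

/-- Slicing a simplex along one coordinate; this is the induction step of both bounds on weighted
sums. -/
lemma lintegral_simplexVolume (n : ℕ) (t : ℝ) {c : ℝ} (hc : 0 < c) :
    ∫⁻ x in Set.Ioi 0, ENNReal.ofReal (simplexVolume n (t - c * x))
      = ENNReal.ofReal (simplexVolume (n + 1) t * c⁻¹) := by
  rcases le_or_gt t 0 with ht | ht
  · rw [setLIntegral_congr_fun (g := fun _ => 0) measurableSet_Ioi]
    · simp [simplexVolume, ht.not_gt]
    · intro x hx
      have : 0 < c * x := mul_pos hc hx
      simp [simplexVolume, show ¬ c * x < t by linarith]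
  · have htc : 0 < t / c := by positivity
    have hsplit : ∫⁻ x in Set.Ioi 0, ENNReal.ofReal (simplexVolume n (t - c * x))
        = ∫⁻ x in Set.Ioc 0 (t / c), ENNReal.ofReal ((t - c * x) ^ n / n.factorial) := by
      rw [← setLIntegral_congr (Ioo_ae_eq_Ioc (a := (0 : ℝ)) (b := t / c)),
        ← lintegral_indicator measurableSet_Ioi, ← lintegral_indicator measurableSet_Ioo]
      refine lintegral_congr fun x => ?_
      by_cases hx : 0 < x
      · by_cases hx2 : x < t / c
        · have : 0 < t - c * x := by
            rw [lt_div_iff₀ hc] at hx2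
            linarith
          simp [Set.indicator, hx, hx2, simplexVolume, show c * x < t by linarith]
        · have : ¬ c * x < t := by
            rw [lt_div_iff₀ hc] at hx2
            linarith
          simp [Set.indicator, hx2, simplexVolume, this]
      · simp [Set.indicator, hx]
    rw [hsplit, ← ofReal_integral_eq_lintegral_ofReal]
    · rw [← intervalIntegral.integral_of_le htc.le,
        intervalIntegral.integral_comp_sub_mul (fun y => y ^ n / (n.factorial : ℝ)) hc.ne']
      congr 1
      rw [mul_div_cancel₀ _ hc.ne', mul_zero, sub_self, sub_zero, intervalIntegral.integral_div,
        integral_pow, simplexVolume, if_pos ht, Nat.factorial_succ]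
      push_cast
      have := Nat.factorial_ne_zero n
      simp only [smul_eq_mul]
      field_simp
      simp
    · exact (Continuous.integrableOn_Icc (by fun_prop)).mono_set Set.Ioc_subset_Icc_self
    · filter_upwards [ae_restrict_mem measurableSet_Ioc] with x hx
      have hx2 := (le_div_iff₀ hc).1 hx.2
      have : 0 ≤ t - c * x := by linarith
      show (0 : ℝ) ≤ _
      positivity

section WeightedSum

variable {Ω ι : Type*} [MeasurableSpace Ω] {μ : Measure Ω}
  {X : ι → Ω → ℝ}

/-- Fubini, after conditioning on `X i`, which is independent of the rest of the sum. -/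
lemma measure_weightedSum_insert [IsProbabilityMeasure μ] (hX : ∀ i, Measurable (X i))
    (hind : iIndepFun X μ)
    {i : ι} (hlaw : μ.map (X i) = unitExpLaw) (c : ι → ℝ) [DecidableEq ι] {s : Finset ι}
    (hi : i ∉ s) (t : ℝ) :
    μ {ω | ∑ j ∈ insert i s, c j * X j ω < t} =
      ∫⁻ x in Set.Ioi 0, ENNReal.ofReal (Real.exp (-x)) *
        μ {ω | ∑ j ∈ s, c j * X j ω < t - c i * x} := by
  have hS : Measurable fun ω => ∑ j ∈ s, c j * X j ω := by fun_prop
  have hindep : X i ⟂ᵢ[μ] fun ω => ∑ j ∈ s, c j * X j ω := by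
    have h1 : iIndepFun (fun j ω => c j * X j ω) μ :=
      hind.comp (fun j x => c j * x) (fun j => by fun_prop)
    have hdisj : Disjoint ({i} : Finset ι) s := by simpa using hi
    have h2 := hind.indepFun_finset {i} s hdisj hX
    have hφ : Measurable fun f : ({i} : Finset ι) → ℝ => f ⟨i, by simp⟩ :=
      measurable_pi_apply _
    have hψ : Measurable fun f : s → ℝ => ∑ j : s, c j * f j := by fun_prop
    have h3 := h2.comp hφ hψ
    have heq : (fun ω => ∑ j ∈ s, c j * X j ω) = fun ω => ∑ j : s, c j * X j ω :=
      funext fun ω => (Finset.sum_coe_sort s fun j => c j * X j ω).symm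
    rw [heq]
    exact h3
  have hm : MeasurableSet {p : ℝ × ℝ | p.2 < t - c i * p.1} :=
    measurableSet_lt (by fun_prop) (by fun_prop)
  have hset : {ω | ∑ j ∈ insert i s, c j * X j ω < t} =
      (fun ω => (X i ω, ∑ j ∈ s, c j * X j ω)) ⁻¹' {p : ℝ × ℝ | p.2 < t - c i * p.1} := by
    ext ω
    simp only [Set.mem_ofPred_eq, Set.mem_preimage, Finset.sum_insert hi]
    constructor <;> intro h <;> linarith
  rw [hset, ← Measure.map_apply ((hX i).prodMk hS) hm,
    (indepFun_iff_map_prod_eq_prod_map_map (hX i).aemeasurable hS.aemeasurable).1 hindep,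
    Measure.prod_apply hm, hlaw, lintegral_unitExpLaw]
  · refine lintegral_congr fun x => ?_
    rw [Measure.map_apply hS (measurable_prodMk_left hm)]
    rfl
  · exact measurable_measure_prodMk_left hm

/-- The exponential density is at most 1, so the probability is at most the volume of the region. -/
theorem measure_weightedSum_lt_le [IsProbabilityMeasure μ] (hX : ∀ i, Measurable (X i))
    (hind : iIndepFun X μ)
    (hlaw : ∀ i, μ.map (X i) = unitExpLaw) {c : ι → ℝ} (hc : ∀ i, 0 < c i)
    (s : Finset ι) (t : ℝ) :
    μ {ω | ∑ j ∈ s, c j * X j ω < t} ≤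
      ENNReal.ofReal (simplexVolume s.card t * ∏ j ∈ s, (c j)⁻¹) := by
  classical
  induction s using Finset.induction_on generalizing t with
  | empty =>
    by_cases ht : 0 < t <;> simp [simplexVolume, ht]
  | insert i s hi ih =>
    have hprod : 0 ≤ ∏ j ∈ s, (c j)⁻¹ := Finset.prod_nonneg fun j _ => (inv_pos.2 (hc j)).le
    rw [measure_weightedSum_insert hX hind (hlaw i) c hi t, Finset.card_insert_of_notMem hi,
      Finset.prod_insert hi, ← mul_assoc, ENNReal.ofReal_mul' hprod,
      ← lintegral_simplexVolume _ _ (hc i), ← lintegral_mul_const _ (by fun_prop)]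
    refine setLIntegral_mono (by fun_prop) fun x hx => ?_
    rw [← ENNReal.ofReal_mul (simplexVolume_nonneg _ _)]
    calc _ ≤ 1 * μ {ω | ∑ j ∈ s, c j * X j ω < t - c i * x} := by
          gcongr
          rw [ENNReal.ofReal_le_one, Real.exp_le_one_iff]
          exact neg_nonpos.2 (le_of_lt hx)
      _ ≤ _ := by
          rw [one_mul]
          exact ih _

/-- On the simplex each coordinate is at most `t / c j`, so the joint density is at least `exp (-(t
* ∑ (c j)⁻¹))`. -/
theorem le_measure_weightedSum_lt [IsProbabilityMeasure μ] (hX : ∀ i, Measurable (X i))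
    (hind : iIndepFun X μ)
    (hlaw : ∀ i, μ.map (X i) = unitExpLaw) {c : ι → ℝ} (hc : ∀ i, 0 < c i)
    (s : Finset ι) (t : ℝ) :
    ENNReal.ofReal (simplexVolume s.card t * (∏ j ∈ s, (c j)⁻¹) *
        Real.exp (-(t * ∑ j ∈ s, (c j)⁻¹))) ≤
      μ {ω | ∑ j ∈ s, c j * X j ω < t} := by
  classical
  induction s using Finset.induction_on generalizing t with
  | empty =>
    by_cases ht : 0 < t <;> simp [simplexVolume, ht]
  | insert i s hi ih =>
    have hprod : 0 ≤ ∏ j ∈ s, (c j)⁻¹ := Finset.prod_nonneg fun j _ => (inv_pos.2 (hc j)).le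
    have hsum : 0 ≤ ∑ j ∈ s, (c j)⁻¹ := Finset.sum_nonneg fun j _ => (inv_pos.2 (hc j)).le
    rw [measure_weightedSum_insert hX hind (hlaw i) c hi t, Finset.card_insert_of_notMem hi,
      Finset.prod_insert hi, ← mul_assoc, mul_assoc, ENNReal.ofReal_mul' (by positivity),
      ← lintegral_simplexVolume _ _ (hc i), ← lintegral_mul_const _ (by fun_prop)]
    refine setLIntegral_mono_ae' measurableSet_Ioi (ae_of_all _ fun x hx => ?_)
    have hx' : 0 < x := hx
    rw [← ENNReal.ofReal_mul (simplexVolume_nonneg _ _)]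
    refine le_trans ?_ (mul_le_mul_right (ih (t - c i * x)) _)
    rw [← ENNReal.ofReal_mul (Real.exp_pos _).le]
    refine ENNReal.ofReal_le_ofReal ?_
    by_cases hpos : 0 < t - c i * x
    · have hxt : x ≤ t * (c i)⁻¹ := by
        rw [← div_eq_mul_inv, le_div_iff₀ (hc i)]
        linarith
      have hexp : Real.exp (-(t * ∑ j ∈ insert i s, (c j)⁻¹)) ≤
          Real.exp (-x) * Real.exp (-((t - c i * x) * ∑ j ∈ s, (c j)⁻¹)) := by
        rw [← Real.exp_add, Finset.sum_insert hi]
        refine Real.exp_le_exp.2 ?_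
        have : 0 ≤ c i * x * ∑ j ∈ s, (c j)⁻¹ := by
          have := hc i
          positivity
        nlinarith
      have h0 : 0 ≤ simplexVolume s.card (t - c i * x) * ∏ j ∈ s, (c j)⁻¹ :=
        mul_nonneg (simplexVolume_nonneg _ _) hprod
      calc _ = (simplexVolume s.card (t - c i * x) * ∏ j ∈ s, (c j)⁻¹) *
            Real.exp (-(t * ∑ j ∈ insert i s, (c j)⁻¹)) := by ring
        _ ≤ _ := mul_le_mul_of_nonneg_left hexp h0
        _ = _ := by ring
    · simp [simplexVolume, show ¬ c i * x < t by linarith]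

lemma unitExpLaw_Iio_le (t : ℝ) : unitExpLaw (Set.Iio t) ≤ ENNReal.ofReal t := by
  rw [unitExpLaw, withDensity_apply _ measurableSet_Iio,
    Measure.restrict_restrict measurableSet_Iio]
  calc _ ≤ ∫⁻ x in Set.Iio t ∩ Set.Ioi 0, 1 := by
        refine setLIntegral_mono measurable_one fun x hx => ?_
        rw [ENNReal.ofReal_le_one, Real.exp_le_one_iff]
        exact neg_nonpos.2 (le_of_lt hx.2)
    _ = ENNReal.ofReal t := by
        rw [setLIntegral_one, Set.inter_comm, Set.Ioi_inter_Iio, Real.volume_Ioo, sub_zero]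

theorem measure_forall_lt_le (hX : ∀ i, Measurable (X i)) (hind : iIndepFun X μ)
    (hlaw : ∀ i, μ.map (X i) = unitExpLaw) {b : ι → ℝ} (hb : ∀ i, 0 ≤ b i) (s : Finset ι) :
    μ {ω | ∀ i ∈ s, X i ω < b i} ≤ ENNReal.ofReal (∏ i ∈ s, b i) := by
  have hset : {ω | ∀ i ∈ s, X i ω < b i} = ⋂ i ∈ s, X i ⁻¹' Set.Iio (b i) := by
    ext ω
    simp
  rw [hset, hind.measure_inter_preimage_eq_mul s (sets := fun i => Set.Iio (b i))
    fun i _ => measurableSet_Iio, ENNReal.ofReal_prod_of_nonneg fun i _ => hb i]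
  refine Finset.prod_le_prod' fun i _ => ?_
  rw [← Measure.map_apply (hX i) measurableSet_Iio, hlaw i]
  exact unitExpLaw_Iio_le (b i)

end WeightedSum

/-! ### Monotonicity and concavity of the capacity function -/

lemma gaussCap_nonneg {x : ℝ} (hx : 0 ≤ x) : 0 ≤ gaussCap x :=
  Real.logb_nonneg one_lt_two (by linarith)

lemma gaussCap_mono {x y : ℝ} (hx : 0 ≤ x) (hxy : x ≤ y) : gaussCap x ≤ gaussCap y :=
  Real.logb_le_logb_of_le one_lt_two (by linarith) (by linarith)

lemma gaussCap_lt_iff {x r : ℝ} (hx : 0 ≤ x) : gaussCap x < r ↔ x < 2 ^ r - 1 := by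
  rw [gaussCap, Real.logb_lt_iff_lt_rpow one_lt_two (by linarith), lt_sub_iff_add_lt']

lemma sum_mul_gaussCap_le {ι : Type*} {s : Finset ι} {w x : ι → ℝ} (hw : ∀ i ∈ s, 0 ≤ w i)
    (hsum : ∑ i ∈ s, w i = 1) (hx : ∀ i ∈ s, 0 ≤ x i) :
    ∑ i ∈ s, w i * gaussCap (x i) ≤ gaussCap (∑ i ∈ s, w i * x i) := by
  have h := strictConcaveOn_log_Ioi.concaveOn.le_map_sum (p := fun i => 1 + x i) hw hsum
    fun i hi => by
      have := hx i hi
      show (0 : ℝ) < 1 + x i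
      linarith
  simp only [smul_eq_mul, mul_add, mul_one, Finset.sum_add_distrib, hsum] at h
  simp only [gaussCap, Real.logb, ← mul_div_assoc, ← Finset.sum_div]
  exact div_le_div_of_nonneg_right h (Real.log_nonneg one_le_two)

/-- The perspective `t ↦ t C(c / t)` is nondecreasing. -/
lemma mul_gaussCap_div_mono {s t c : ℝ} (hs : 0 < s) (hst : s ≤ t) (hc : 0 ≤ c) :
    s * gaussCap (c / s) ≤ t * gaussCap (c / t) := by
  have ht : 0 < t := hs.trans_le hst
  -- Jensen at the points `c / s` and `0`, with weights `s / t` and `1 - s / t`; the capacity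
  -- vanishes at `0`.
  have h := sum_mul_gaussCap_le (s := Finset.univ) (w := ![s / t, 1 - s / t]) (x := ![c / s, 0])
    (by
      intro i _
      fin_cases i
      · exact (div_pos hs ht).le
      · simpa using (div_le_one ht).2 hst)
    (by simp)
    (by
      intro i _
      fin_cases i
      · exact div_nonneg hc hs.le
      · exact le_rfl)
  simp only [Fin.sum_univ_two, Matrix.cons_val_zero, Matrix.cons_val_one] at h
  rw [mul_zero, add_zero, show gaussCap 0 = 0 by simp [gaussCap], mul_zero, add_zero,
    show s / t * (c / s) = c / t by field_simp] at h
  calc _ = t * (s / t * gaussCap (c / s)) := by field_simp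
    _ ≤ _ := mul_le_mul_of_nonneg_left h ht.le

namespace UserCoopNetwork

variable {K : ℕ} (N : UserCoopNetwork K) (pw : Fin K → ℝ) (a : Option (Fin K) → Fin K → ℂ)

lemma norm_fadingGain_sq {m : Option (Fin K)} {j : Fin K} (h : m ≠ some j) :
    ‖N.fadingGain a m j‖ ^ 2 = ‖a m j‖ ^ 2 / N.dist m j ^ N.pathLoss := by
  have hd := N.dist_pos m j h
  rw [fadingGain, norm_div, div_pow, Complex.norm_real, Real.norm_eq_abs, sq_abs,
    ← Real.rpow_natCast (N.dist m j ^ (N.pathLoss / 2)), ← Real.rpow_mul hd.le]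
  congr 2
  push_cast
  ring

/-! ### The order of the transmitters -/

lemma nextUser_mem {S : Finset (Fin K)} (h : (N.coop \ S).Nonempty) :
    N.nextUser pw a S ∈ N.coop \ S := by
  obtain ⟨j, hj, hmin⟩ := Finset.exists_min_image _ (N.decodeFraction pw a S) h
  have hne : ((N.coop \ S).filter (fun j => ∀ i ∈ N.coop \ S,
      N.decodeFraction pw a S j ≤ N.decodeFraction pw a S i)).Nonempty :=
    ⟨j, Finset.mem_filter.2 ⟨hj, hmin⟩⟩
  rw [nextUser, ← Finset.coe_min' hne, WithTop.untopD_coe]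
  exact (Finset.mem_filter.1 (Finset.min'_mem _ hne)).1

lemma activeUsers_succ (l : ℕ) : N.activeUsers pw a (l + 1) =
    insert (N.order pw a (l + 1)) (N.activeUsers pw a l) := rfl

lemma order_succ (l : ℕ) : N.order pw a (l + 1) = N.nextUser pw a (N.activeUsers pw a l) := rfl

lemma activeUsers_eq_image (l : ℕ) :
    N.activeUsers pw a l = (Finset.range (l + 1)).image (N.order pw a) := by
  induction l with
  | zero => rfl
  | succ l ih => rw [activeUsers_succ, ih, Finset.range_add_one (n := l + 1), Finset.image_insert]

lemma card_transmitters : N.transmitters.card = N.hops := by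
  rw [transmitters, Finset.card_insert_of_notMem N.source_notMem, hops]

lemma source_mem_activeUsers (l : ℕ) : N.source ∈ N.activeUsers pw a l := by
  rw [activeUsers_eq_image]
  exact Finset.mem_image.2 ⟨0, by simp, rfl⟩

lemma coop_sdiff {S : Finset (Fin K)} (h : N.source ∈ S) : N.coop \ S = N.transmitters \ S := by
  rw [transmitters, Finset.insert_sdiff_of_mem _ h]

/-- Before the last slot some cooperating user is still listening, so the default value of
`nextUser` is not taken and each slot adds a new user. -/
lemma activeUsers_spec (l : ℕ) (hl : l < N.hops) :
    N.activeUsers pw a l ⊆ N.transmitters ∧ (N.activeUsers pw a l).card = l + 1 := by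
  induction l with
  | zero =>
    constructor
    · rw [show N.activeUsers pw a 0 = {N.source} from rfl, transmitters]
      simp
    · rfl
  | succ l ih =>
    obtain ⟨h1, h2⟩ := ih (by omega)
    have hne : (N.coop \ N.activeUsers pw a l).Nonempty := by
      rw [coop_sdiff _ (source_mem_activeUsers _ _ _ _), ← Finset.card_pos,
        Finset.card_sdiff_of_subset h1, card_transmitters, h2]
      omega
    have hmem := N.nextUser_mem pw a hne
    rw [← order_succ, Finset.mem_sdiff] at hmem
    rw [activeUsers_succ]
    refine ⟨Finset.insert_subset (Finset.mem_insert_of_mem hmem.1) h1, ?_⟩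
    rw [Finset.card_insert_of_notMem hmem.2, h2]

lemma activeUsers_last : N.activeUsers pw a (N.hops - 1) = N.transmitters := by
  have hpos : 0 < N.hops := Nat.succ_pos _
  obtain ⟨h1, h2⟩ := N.activeUsers_spec pw a (N.hops - 1) (by omega)
  exact Finset.eq_of_subset_of_card_le h1 (by rw [card_transmitters, h2]; omega)

lemma image_order : (Finset.range N.hops).image (N.order pw a) = N.transmitters := by
  have hpos : 0 < N.hops := Nat.succ_pos _
  rw [← N.activeUsers_last pw a, activeUsers_eq_image, Nat.sub_add_cancel hpos]

lemma injOn_order : Set.InjOn (N.order pw a) (Finset.range N.hops) := by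
  rw [← Finset.card_image_iff, image_order, card_transmitters, Finset.card_range]

lemma sum_order (f : Fin K → ℝ) :
    ∑ l ∈ Finset.range N.hops, f (N.order pw a l) = ∑ j ∈ N.transmitters, f j := by
  rw [← N.image_order pw a, Finset.sum_image (N.injOn_order pw a)]

/-! ### The lengths of the slots -/

lemma fraction_nonneg (l : ℕ) : 0 ≤ N.fraction pw a l := ENNReal.toReal_nonneg

lemma remaining_zero : N.remaining pw a 0 = 1 := by simp [remaining, elapsed]

lemma remaining_succ (l : ℕ) :
    N.remaining pw a (l + 1) = N.remaining pw a l - N.fraction pw a l := by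
  simp only [remaining, elapsed, fraction]
  ring

lemma fraction_le_remaining_of_nonneg {l : ℕ} (h : 0 ≤ N.remaining pw a l) :
    N.fraction pw a l ≤ N.remaining pw a l := by
  rw [fraction, slotLength]
  exact (ENNReal.toReal_mono ENNReal.ofReal_ne_top (min_le_left _ _)).trans_eq
    (ENNReal.toReal_ofReal h)

lemma remaining_nonneg (l : ℕ) : 0 ≤ N.remaining pw a l := by
  induction l with
  | zero => simp [remaining_zero]
  | succ l ih =>
    rw [remaining_succ, sub_nonneg]
    exact N.fraction_le_remaining_of_nonneg pw a ih

lemma fraction_le_remaining (l : ℕ) : N.fraction pw a l ≤ N.remaining pw a l :=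
  N.fraction_le_remaining_of_nonneg pw a (N.remaining_nonneg pw a l)

lemma remaining_eq (l : ℕ) :
    N.remaining pw a l = 1 - ∑ i ∈ Finset.range l, N.fraction pw a i := by
  induction l with
  | zero => simp [remaining_zero]
  | succ l ih =>
    rw [remaining_succ, ih, Finset.sum_range_succ]
    ring

lemma remaining_le_one (l : ℕ) : N.remaining pw a l ≤ 1 := by
  rw [remaining_eq, sub_le_self_iff]
  exact Finset.sum_nonneg fun i _ => N.fraction_nonneg pw a i

lemma fraction_last : N.fraction pw a (N.hops - 1) = N.remaining pw a (N.hops - 1) := by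
  have h := N.remaining_nonneg pw a (N.hops - 1)
  have hempty : N.coop \ N.transmitters = ∅ :=
    Finset.sdiff_eq_empty_iff_subset.2 (Finset.subset_insert _ _)
  rw [fraction, slotLength, activeUsers_last, hempty, Finset.inf_empty, min_top_right]
  exact ENNReal.toReal_ofReal h

lemma remaining_hops : N.remaining pw a N.hops = 0 := by
  have hpos : 0 < N.hops := Nat.succ_pos _
  have h := N.remaining_succ pw a (N.hops - 1)
  rwa [Nat.sub_add_cancel hpos, fraction_last, sub_self] at h

lemma sum_fraction : ∑ l ∈ Finset.range N.hops, N.fraction pw a l = 1 := by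
  have h := N.remaining_eq pw a N.hops
  rw [remaining_hops] at h
  linarith

lemma sum_Ico_fraction {i : ℕ} (hi : i ≤ N.hops) :
    ∑ l ∈ Finset.Ico i N.hops, N.fraction pw a l = N.remaining pw a i := by
  rw [Finset.sum_Ico_eq_sub _ hi, sum_fraction, remaining_eq]

/-! ### Comparison with the distributed MIMO channel -/

variable {pw}

lemma received_nonneg (hpw : ∀ j, 0 ≤ pw j) (i : ℕ) :
    0 ≤ ‖N.fadingGain a none (N.order pw a i)‖ ^ 2 *
      (pw (N.order pw a i) / N.remaining pw a i) :=
  mul_nonneg (sq_nonneg _) (div_nonneg (hpw _) (N.remaining_nonneg pw a i))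

/-- Jensen over the slots, followed by an exchange of the double sum: the user starting in slot `i`
transmits at power `pw / remaining i` for a total time `remaining i`, hence spends `pw`. -/
lemma ddfInfo_le (hpw : ∀ j, 0 ≤ pw j) :
    N.ddfInfo pw a ≤ gaussCap (∑ j ∈ N.transmitters, ‖N.fadingGain a none j‖ ^ 2 * pw j) := by
  refine (sum_mul_gaussCap_le (fun i _ => N.fraction_nonneg pw a i) (N.sum_fraction pw a)
    fun l _ => Finset.sum_nonneg fun i _ => N.received_nonneg a hpw i).trans ?_
  refine gaussCap_mono (Finset.sum_nonneg fun l _ => mul_nonneg (N.fraction_nonneg pw a l)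
    (Finset.sum_nonneg fun i _ => N.received_nonneg a hpw i)) ?_
  rw [← N.sum_order pw a fun j => ‖N.fadingGain a none j‖ ^ 2 * pw j]
  simp only [Finset.mul_sum, Finset.range_eq_Ico]
  rw [Finset.sum_sigma', Finset.sum_bij'
    (t := (Finset.Ico 0 N.hops).sigma fun i => Finset.Ico i N.hops)
    (g := fun x => N.fraction pw a x.2 * (‖N.fadingGain a none (N.order pw a x.1)‖ ^ 2 *
      (pw (N.order pw a x.1) / N.remaining pw a x.1)))
    (fun x _ => ⟨x.2, x.1⟩) (fun x _ => ⟨x.2, x.1⟩)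
    (by simp only [Finset.mem_sigma, Finset.mem_Ico]; omega)
    (by simp only [Finset.mem_sigma, Finset.mem_Ico]; omega)
    (by simp) (by simp) (by simp), Finset.sum_sigma]
  refine Finset.sum_le_sum fun i hi => ?_
  dsimp only
  rw [← Finset.sum_mul, sum_Ico_fraction _ _ _ (Finset.mem_Ico.1 hi).2.le]
  have h0 : 0 ≤ ‖N.fadingGain a none (N.order pw a i)‖ ^ 2 * pw (N.order pw a i) :=
    mul_nonneg (sq_nonneg _) (hpw _)
  -- A user that starts when no time is left contributes nothing, so only an inequality holds here.
  rcases (N.remaining_nonneg pw a i).eq_or_lt with h | h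
  · rwa [← h, zero_mul]
  · refine le_of_eq ?_
    field_simp

/-! ### Outage events -/

lemma mul_slotInfo_le_ddfInfo (hpw : ∀ j, 0 ≤ pw j) {l : ℕ} (hl : l < N.hops) :
    N.fraction pw a l * N.slotInfo pw a l ≤ N.ddfInfo pw a :=
  Finset.single_le_sum (f := fun l => N.fraction pw a l * N.slotInfo pw a l)
    (fun i _ => mul_nonneg (N.fraction_nonneg pw a i)
    (gaussCap_nonneg (Finset.sum_nonneg fun i _ => N.received_nonneg a hpw i)))
    (Finset.mem_range.2 hl)

lemma sum_activeUsers (f : Fin K → ℝ) {l : ℕ} (hl : l < N.hops) :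
    ∑ j ∈ N.activeUsers pw a l, f j = ∑ i ∈ Finset.range (l + 1), f (N.order pw a i) := by
  rw [activeUsers_eq_image, Finset.sum_image]
  refine (N.injOn_order pw a).mono fun i hi => ?_
  simp only [Finset.coe_range, Set.mem_Iio] at hi ⊢
  omega

/-- If slot `l` takes more than `t` and the destination is in outage, then every link from the
users active in slot `l` to the listening users and to the destination is weak. -/
lemma weak_links_of_lt_fraction (hpw : ∀ j, 0 ≤ pw j) (hout : N.ddfInfo pw a < N.rate)
    {l : ℕ} (hl : l < N.hops) {t : ℝ} (ht : 0 < t) (hlt : t < N.fraction pw a l)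
    {j : Fin K} (hj : j ∈ N.activeUsers pw a l) :
    ‖N.fadingGain a none j‖ ^ 2 * pw j < 2 ^ (N.rate / t) - 1 ∧
    ∀ i ∈ N.transmitters \ N.activeUsers pw a l,
      ‖N.fadingGain a (some i) j‖ ^ 2 * pw j < 2 ^ (N.rate / t) - 1 := by
  have hgain : ∀ m i, 0 ≤ ‖N.fadingGain a m i‖ ^ 2 * pw i := fun m i =>
    mul_nonneg (sq_nonneg _) (hpw i)
  have hle : ∀ m, ‖N.fadingGain a m j‖ ^ 2 * pw j ≤
      ∑ i ∈ N.activeUsers pw a l, ‖N.fadingGain a m i‖ ^ 2 * pw i := fun m =>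
    Finset.single_le_sum (f := fun i => ‖N.fadingGain a m i‖ ^ 2 * pw i)
      (fun i _ => hgain m i) hj
  constructor
  · refine (hle none).trans_lt ((gaussCap_lt_iff (Finset.sum_nonneg fun i _ => hgain _ i)).1 ?_)
    -- Scaling by the inverse of a time fraction, which is at most 1, only raises the power.
    have hcap : gaussCap (∑ i ∈ N.activeUsers pw a l, ‖N.fadingGain a none i‖ ^ 2 * pw i) ≤
        N.slotInfo pw a l := by
      refine gaussCap_mono (Finset.sum_nonneg fun i _ => hgain _ i) ?_
      rw [sum_activeUsers _ _ _ hl]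
      refine Finset.sum_le_sum fun i hi => ?_
      refine mul_le_mul_of_nonneg_left ?_ (sq_nonneg _)
      have hfr : 0 < N.remaining pw a i := by
        refine ht.trans (hlt.trans_le ?_)
        rw [← N.sum_Ico_fraction pw a (by have := Finset.mem_range.1 hi; omega)]
        exact Finset.single_le_sum (fun i _ => N.fraction_nonneg pw a i)
          (Finset.mem_Ico.2 ⟨by have := Finset.mem_range.1 hi; omega, hl⟩)
      rw [le_div_iff₀ hfr]
      exact mul_le_of_le_one_right (hpw _) (N.remaining_le_one pw a i)
    have h0 := gaussCap_nonneg
      (Finset.sum_nonneg fun i (_ : i ∈ N.activeUsers pw a l) => hgain none i)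
    rw [lt_div_iff₀ ht, mul_comm]
    calc _ ≤ N.fraction pw a l * N.slotInfo pw a l :=
          mul_le_mul hlt.le hcap h0 (N.fraction_nonneg pw a l)
      _ ≤ N.ddfInfo pw a := N.mul_slotInfo_le_ddfInfo a hpw hl
      _ < N.rate := hout
  · intro i hi
    refine (hle (some i)).trans_lt
      ((gaussCap_lt_iff (Finset.sum_nonneg fun i _ => hgain _ i)).1 ?_)
    rw [← N.coop_sdiff (N.source_mem_activeUsers pw a l)] at hi
    -- The slot ends no later than user `i` decodes, and it lasts longer than `t`.
    have h1 : ENNReal.ofReal t < N.decodeFraction pw a (N.activeUsers pw a l) i := by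
      have h2 : ENNReal.ofReal t < min (ENNReal.ofReal (1 - N.elapsed pw a l))
          ((N.coop \ N.activeUsers pw a l).inf (N.decodeFraction pw a (N.activeUsers pw a l))) :=
        (ENNReal.ofReal_lt_iff_lt_toReal ht.le
          (ne_top_of_le_ne_top ENNReal.ofReal_ne_top (min_le_left _ _))).2 hlt
      exact h2.trans_le ((min_le_right _ _).trans (Finset.inf_le hi))
    by_contra! hcon
    refine absurd h1 (not_lt.2 ?_)
    rw [decodeFraction]
    have hpos : 0 < N.rate / t := div_pos N.rate_pos ht
    rw [← ENNReal.ofReal_div_of_pos (hpos.trans_le hcon)]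
    refine ENNReal.ofReal_le_ofReal ?_
    rw [div_le_iff₀ ht] at hcon
    rw [div_le_iff₀ (hpos.trans_le (by rwa [div_le_iff₀ ht]))]
    linarith

/-- If no slot but the last one is longer than its reference fraction, then outage of the
destination means that a weighted sum of the destination gains is small. -/
lemma weightedSum_lt_of_fraction_le (hpw : ∀ j, 0 ≤ pw j) (hout : N.ddfInfo pw a < N.rate)
    {θ : ℕ → ℝ} (hθ : ∀ l < N.hops, 0 < θ l) (hsum : ∑ l ∈ Finset.range N.hops, θ l = 1)
    (hle : ∀ l < N.hops - 1, N.fraction pw a l ≤ θ l) :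
    ∑ l ∈ Finset.range N.hops, ‖N.fadingGain a none (N.order pw a l)‖ ^ 2 *
      (pw (N.order pw a l) / (1 - ∑ i ∈ Finset.range l, θ i)) <
        2 ^ (N.rate / θ (N.hops - 1)) - 1 := by
  obtain ⟨n, hn⟩ : ∃ n, N.hops = n + 1 := ⟨_, rfl⟩
  have hlast := N.fraction_last pw a
  have hinfo := N.mul_slotInfo_le_ddfInfo a hpw (l := n) (by omega)
  have hθbar : ∀ l, l ≤ n → 1 - ∑ i ∈ Finset.range l, θ i = ∑ i ∈ Finset.Ico l (n + 1), θ i := by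
    intro l hl
    rw [Finset.sum_Ico_eq_sub _ (by omega), ← hn, hsum]
  have hrem : ∀ l, l ≤ n →
      N.remaining pw a l = ∑ i ∈ Finset.Ico l (n + 1), N.fraction pw a i := by
    intro l hl
    rw [← N.sum_Ico_fraction pw a (by omega), hn]
  rw [hn] at hθ hsum hle hlast
  simp only [hn, Nat.add_sub_cancel] at hle hlast ⊢
  have hθn := hθ n (by omega)
  have hθbarpos : ∀ l, l ≤ n → 0 < 1 - ∑ i ∈ Finset.range l, θ i := by
    intro l hl
    rw [hθbar l hl]
    exact Finset.sum_pos (fun i hi => hθ i (Finset.mem_Ico.1 hi).2)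
      (Finset.nonempty_Ico.2 (by omega))
  -- Both families sum to 1, and every other fraction is at most its reference.
  have hfn : θ n ≤ N.fraction pw a n := by
    have h1 := N.sum_fraction pw a
    rw [hn, Finset.sum_range_succ] at h1
    rw [Finset.sum_range_succ] at hsum
    have h2 := Finset.sum_le_sum fun i (hi : i ∈ Finset.range n) => hle i (Finset.mem_range.1 hi)
    linarith
  have hfpos : 0 < N.fraction pw a n := hθn.trans_le hfn
  set y := ∑ l ∈ Finset.range (n + 1), ‖N.fadingGain a none (N.order pw a l)‖ ^ 2 *
      (pw (N.order pw a l) / (1 - ∑ i ∈ Finset.range l, θ i)) with hy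
  have hy0 : 0 ≤ y := Finset.sum_nonneg fun l hl => mul_nonneg (sq_nonneg _)
    (div_nonneg (hpw _) (hθbarpos l (by have := Finset.mem_range.1 hl; omega)).le)
  rw [← gaussCap_lt_iff hy0, lt_div_iff₀ hθn, mul_comm]
  have hslot : θ n * y / N.fraction pw a n ≤ ∑ i ∈ Finset.range (n + 1),
      ‖N.fadingGain a none (N.order pw a i)‖ ^ 2 *
        (pw (N.order pw a i) / N.remaining pw a i) := by
    rw [hy, Finset.mul_sum, Finset.sum_div]
    refine Finset.sum_le_sum fun l hl => ?_
    have hl' : l ≤ n := by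
      have := Finset.mem_range.1 hl
      omega
    have hrpos : 0 < N.remaining pw a l := by
      rw [hrem l hl', Finset.sum_Ico_succ_top hl']
      exact add_pos_of_nonneg_of_pos
        (Finset.sum_nonneg fun i _ => N.fraction_nonneg pw a i) hfpos
    -- The last slot is a larger share of the time from slot `l` on than under the reference: the
    -- common term `θ n * fraction n` cancels, and the other terms compare factorwise.
    have hkey : θ n * N.remaining pw a l ≤
        N.fraction pw a n * (1 - ∑ i ∈ Finset.range l, θ i) := by
      rw [hrem l hl', hθbar l hl', Finset.sum_Ico_succ_top hl', Finset.sum_Ico_succ_top hl',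
        mul_add, mul_add, mul_comm (θ n) (N.fraction pw a n)]
      gcongr ?_ + _
      have h1 := Finset.sum_le_sum fun i (hi : i ∈ Finset.Ico l n) =>
        hle i (Finset.mem_Ico.1 hi).2
      exact mul_le_mul hfn h1 (Finset.sum_nonneg fun i _ => N.fraction_nonneg pw a i) hfpos.le
    have hg : 0 ≤ ‖N.fadingGain a none (N.order pw a l)‖ ^ 2 * pw (N.order pw a l) :=
      mul_nonneg (sq_nonneg _) (hpw _)
    have hθl := hθbarpos l hl'
    rw [← mul_div_assoc, ← mul_div_assoc, ← mul_div_assoc, div_div,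
      div_le_div_iff₀ (by positivity) hrpos]
    nlinarith [mul_le_mul_of_nonneg_left hkey hg]
  calc θ n * gaussCap y = θ n * gaussCap (θ n * y / θ n) := by field_simp
    _ ≤ N.fraction pw a n * gaussCap (θ n * y / N.fraction pw a n) :=
        mul_gaussCap_div_mono hθn hfn (by positivity)
    _ ≤ N.fraction pw a n * N.slotInfo pw a n :=
        mul_le_mul_of_nonneg_left (gaussCap_mono (by positivity) hslot) hfpos.le
    _ ≤ N.ddfInfo pw a := hinfo
    _ < N.rate := hout

end UserCoopNetwork

namespace UserCoopNetwork

variable {K : ℕ} (N : UserCoopNetwork K) (pw : Fin K → ℝ)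

/-! ### Measurability of the order of the transmitters -/

section Measurability

variable {Ω : Type*} [MeasurableSpace Ω] {A : Option (Fin K) → Fin K → Ω → ℂ}

lemma measurable_decodeFraction (hA : ∀ i j, i ≠ j → Measurable (A (some i) j))
    {S : Finset (Fin K)} {j : Fin K} (hj : j ∉ S) :
    Measurable fun ω => N.decodeFraction pw (fun m j => A m j ω) S j := by
  have hsum : Measurable fun ω =>
      ∑ m ∈ S, ‖N.fadingGain (fun m j => A m j ω) (some j) m‖ ^ 2 * pw m := by
    refine Finset.measurable_fun_sum _ fun m hm => ?_
    have := hA j m (fun h => hj (h ▸ hm))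
    unfold fadingGain
    fun_prop
  unfold decodeFraction gaussCap Real.logb
  fun_prop

/-- The next user is a function of the finite table `r` of pairwise comparisons. -/
lemma measurableSet_nextUser (hA : ∀ i j, i ≠ j → Measurable (A (some i) j))
    (S : Finset (Fin K)) (v : Fin K) :
    MeasurableSet {ω | N.nextUser pw (fun m j => A m j ω) S = v} := by
  classical
  -- Comparisons are restricted to listeners because the decoding time of a member of `S` involves a
  -- self-coefficient, about which nothing is assumed.
  let r : Ω → Fin K → Fin K → Prop := fun ω j i => j ∈ N.coop \ S ∧ i ∈ N.coop \ S ∧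
    N.decodeFraction pw (fun m j => A m j ω) S j ≤ N.decodeFraction pw (fun m j => A m j ω) S i
  have hr : Measurable r := by
    refine measurable_pi_lambda _ fun j => measurable_pi_lambda _ fun i => ?_
    refine measurableSet_setOfPred.1 ?_
    by_cases hji : j ∈ N.coop \ S ∧ i ∈ N.coop \ S
    · simp only [r, hji.1, hji.2, true_and]
      exact measurableSet_le
        (N.measurable_decodeFraction pw hA (Finset.mem_sdiff.1 hji.1).2)
        (N.measurable_decodeFraction pw hA (Finset.mem_sdiff.1 hji.2).2)
    · convert MeasurableSet.empty using 1
      ext ω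
      simp only [r, Set.mem_ofPred_eq, Set.mem_empty_iff_false, iff_false]
      exact fun h => hji ⟨h.1, h.2.1⟩
  let F : (Fin K → Fin K → Prop) → Fin K := fun r =>
    ((N.coop \ S).filter (fun j => ∀ i ∈ N.coop \ S, r j i)).min.untopD N.source
  have hF : ∀ ω, N.nextUser pw (fun m j => A m j ω) S = F (r ω) := by
    intro ω
    refine congrArg (fun s : Finset (Fin K) => s.min.untopD N.source) (Finset.ext fun j => ?_)
    simp only [Finset.mem_filter, r]
    exact and_congr_right fun hj =>
      ⟨fun h i hi => ⟨hj, hi, h i hi⟩, fun h i hi => (h i hi).2.2⟩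
  simp only [hF]
  exact hr ((Set.toFinite {x | F x = v}).measurableSet)

lemma measurableSet_slotState (hA : ∀ i j, i ≠ j → Measurable (A (some i) j)) (l : ℕ)
    (s : Finset (Fin K) × Fin K) :
    MeasurableSet {ω | N.slotState pw (fun m j => A m j ω) l = s} := by
  induction l generalizing s with
  | zero =>
    simp only [slotState]
    exact MeasurableSet.const _
  | succ l ih =>
    have hset : {ω | N.slotState pw (fun m j => A m j ω) (l + 1) = s} =
        ⋃ s' : Finset (Fin K) × Fin K, {ω | N.slotState pw (fun m j => A m j ω) l = s'} ∩
          {ω | N.nextUser pw (fun m j => A m j ω) s'.1 = s.2} ∩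
          {_ω | insert s.2 s'.1 = s.1} := by
      ext ω
      simp only [slotState, Set.mem_ofPred_eq, Set.mem_iUnion, Set.mem_inter_iff, Prod.ext_iff]
      constructor
      · rintro ⟨h1, h2⟩
        exact ⟨_, ⟨⟨rfl, rfl⟩, h2⟩, h2 ▸ h1⟩
      · rintro ⟨s', ⟨⟨h1, h2⟩, h3⟩, h4⟩
        rw [h1, h3]
        exact ⟨h4, rfl⟩
    rw [hset]
    exact MeasurableSet.iUnion fun s' => ((ih s').inter
      (N.measurableSet_nextUser pw hA s'.1 s.2)).inter (MeasurableSet.const _)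

lemma measurable_order (hA : ∀ i j, i ≠ j → Measurable (A (some i) j)) (l : ℕ) :
    Measurable fun ω => N.order pw (fun m j => A m j ω) l := by
  refine measurable_to_countable' fun v => ?_
  have hset : (fun ω => N.order pw (fun m j => A m j ω) l) ⁻¹' {v} =
      ⋃ S : Finset (Fin K), {ω | N.slotState pw (fun m j => A m j ω) l = (S, v)} := by
    ext ω
    simp [order, Prod.ext_iff]
  rw [hset]
  exact MeasurableSet.iUnion fun S => N.measurableSet_slotState pw hA l (S, v)

end Measurability

end UserCoopNetwork

/-! ### The squared moduli of the fading coefficients -/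

namespace IsIIDComplexGaussianFading

variable {K : ℕ} {Ω : Type*} [mΩ : MeasurableSpace Ω] {A : Option (Fin K) → Fin K → Ω → ℂ}
  {μ : Measure Ω} {ι : Type*} {rx : ι → Option (Fin K)} {tx : ι → Fin K}

lemma measurable_normSq (hA : IsIIDComplexGaussianFading A μ) (h : ∀ i, rx i ≠ some (tx i))
    (i : ι) : Measurable fun ω => ‖A (rx i) (tx i) ω‖ ^ 2 := by
  have := hA.measurable _ _ (h i)
  fun_prop

lemma map_normSq (hA : IsIIDComplexGaussianFading A μ) (h : ∀ i, rx i ≠ some (tx i))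
    (i : ι) : μ.map (fun ω => ‖A (rx i) (tx i) ω‖ ^ 2) = unitExpLaw := by
  rw [← map_normSq_stdComplexGaussian, ← hA.law _ _ (h i),
    Measure.map_map (by fun_prop) (hA.measurable _ _ (h i))]
  rfl

lemma iIndepFun_normSq (hA : IsIIDComplexGaussianFading A μ) (h : ∀ i, rx i ≠ some (tx i))
    (hinj : Function.Injective fun i => (rx i, tx i)) :
    iIndepFun (fun i ω => ‖A (rx i) (tx i) ω‖ ^ 2) μ := by
  have h1 := hA.indep.precomp
    (g := fun i : ι => (⟨(rx i, tx i), h i⟩ : {e : Option (Fin K) × Fin K // e.1 ≠ some e.2}))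
    fun i j hij => hinj (congrArg Subtype.val hij)
  exact h1.comp (fun _ z => ‖z‖ ^ 2) fun _ => by fun_prop

/-- Events of the links between users are independent of events of the links to the
destination. -/
lemma exists_indep (hA : IsIIDComplexGaussianFading A μ) :
    ∃ mU mD : MeasurableSpace Ω, Indep mU mD μ ∧
      (∀ i j, i ≠ j → Measurable[mU] (A (some i) j)) ∧ ∀ j, Measurable[mD] (A none j) := by
  let m : {e : Option (Fin K) × Fin K // e.1 ≠ some e.2} → MeasurableSpace Ω :=
    fun e => MeasurableSpace.comap (A e.1.1 e.1.2) inferInstance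
  have hm : ∀ e, m e ≤ mΩ := fun e => (hA.measurable _ _ e.2).comap_le
  let U : Set {e : Option (Fin K) × Fin K // e.1 ≠ some e.2} := {e | e.1.1 ≠ none}
  let D : Set {e : Option (Fin K) × Fin K // e.1 ≠ some e.2} := {e | e.1.1 = none}
  have hdisj : Disjoint U D := Set.disjoint_left.2 fun e h1 h2 => h1 h2
  refine ⟨⨆ e ∈ U, m e, ⨆ e ∈ D, m e,
    indep_iSup_of_disjoint hm hA.indep hdisj, fun i j hij => ?_, fun j => ?_⟩
  · have he : (⟨(some i, j), fun h => hij (Option.some_injective _ h)⟩ :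
      {e : Option (Fin K) × Fin K // e.1 ≠ some e.2}) ∈ U := by simp [U]
    exact (comap_measurable _).mono (le_iSup₂ (f := fun e (_ : e ∈ U) => m e) _ he) le_rfl
  · have he : (⟨(none, j), by simp⟩ :
      {e : Option (Fin K) × Fin K // e.1 ≠ some e.2}) ∈ D := by simp [D]
    exact (comap_measurable _).mono (le_iSup₂ (f := fun e (_ : e ∈ D) => m e) _ he) le_rfl

end IsIIDComplexGaussianFading

/-- Total probability over the values of `π`. The hypothesis ranges over `ω`, so a conditional bound
is needed only at attained values; for `order` these are the injective enumerations of the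
transmitters. -/
lemma measure_setOf_mem_le {Ω α : Type*} [MeasurableSpace Ω] {μ : Measure Ω}
    [IsProbabilityMeasure μ] [Finite α] [MeasurableSpace α] [MeasurableSingletonClass α]
    {π : Ω → α} (hπ : Measurable π) {B : α → Set Ω} {c : ENNReal}
    (h : ∀ ω, μ (π ⁻¹' {π ω} ∩ B (π ω)) ≤ μ (π ⁻¹' {π ω}) * c) :
    μ {ω | ω ∈ B (π ω)} ≤ c := by
  have := Fintype.ofFinite α
  calc _ ≤ μ (⋃ a ∈ (Finset.univ : Finset α), (π ⁻¹' {a} ∩ B a)) :=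
        measure_mono fun ω hω => Set.mem_biUnion (Finset.mem_univ (π ω)) ⟨rfl, hω⟩
    _ ≤ ∑ a, μ (π ⁻¹' {a} ∩ B a) := measure_biUnion_finset_le _ _
    _ ≤ ∑ a, μ (π ⁻¹' {a}) * c := by
        refine Finset.sum_le_sum fun a _ => ?_
        rcases (π ⁻¹' {a}).eq_empty_or_nonempty with ha | ⟨ω, rfl⟩
        · simp [ha]
        · exact h ω
    _ = c := by
        rw [← Finset.sum_mul,
          sum_measure_preimage_singleton _ fun a _ => hπ (measurableSet_singleton a)]
        simp

namespace UserCoopNetwork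

variable {K : ℕ} (N : UserCoopNetwork K) {lam : Fin K → ℝ}
  {Ω : Type*} [MeasurableSpace Ω] {μ : Measure Ω} [IsProbabilityMeasure μ]
  {A : Option (Fin K) → Fin K → Ω → ℂ}

lemma hops_pos : 0 < N.hops := Nat.succ_pos _

lemma two_rpow_sub_one_pos {r : ℝ} (hr : 0 < r) : (0 : ℝ) < 2 ^ r - 1 :=
  sub_pos.2 (Real.one_lt_rpow one_lt_two hr)

lemma dist_rpow_pos {m : Option (Fin K)} {j : Fin K} (h : m ≠ some j) :
    0 < N.dist m j ^ N.pathLoss := Real.rpow_pos_of_pos (N.dist_pos m j h) _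

/-! ### The distributed MIMO channel -/

lemma mimoOutage_eq {μ : Measure Ω} {P : ℝ} (hP : 0 < P) (hlam : ∀ j, 0 < lam j) :
    N.mimoOutage μ A (fun j => lam j * P) =
      μ.real {ω | ∑ j ∈ N.transmitters, lam j / N.dist none j ^ N.pathLoss *
        ‖A none j ω‖ ^ 2 < (2 ^ N.rate - 1) / P} := by
  rw [mimoOutage]
  congr 1
  ext ω
  have h0 : ∀ j, 0 ≤ ‖N.fadingGain (fun m j => A m j ω) none j‖ ^ 2 * (lam j * P) := fun j =>
    mul_nonneg (sq_nonneg _) (mul_pos (hlam j) hP).le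
  rw [Set.mem_ofPred_eq, Set.mem_ofPred_eq, gaussCap_lt_iff (Finset.sum_nonneg fun j _ => h0 j),
    lt_div_iff₀ hP, Finset.sum_mul]
  refine iff_of_eq (congrArg (· < _) (Finset.sum_congr rfl fun j _ => ?_))
  rw [norm_fadingGain_sq _ _ (by simp)]
  ring

theorem mimoOutage_bounds (hlam : ∀ j, 0 < lam j) (hA : IsIIDComplexGaussianFading A μ)
    {P : ℝ} (hP : 0 < P) :
    N.mimoLeadingTerm lam P * Real.exp (-((2 ^ N.rate - 1) / P *
        ∑ j ∈ N.transmitters, N.dist none j ^ N.pathLoss / lam j)) ≤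
      N.mimoOutage μ A (fun j => lam j * P) ∧
    N.mimoOutage μ A (fun j => lam j * P) ≤ N.mimoLeadingTerm lam P := by
  have hne : ∀ j : Fin K, (none : Option (Fin K)) ≠ some j := by simp
  have hc : ∀ j, 0 < lam j / N.dist none j ^ N.pathLoss := fun j =>
    div_pos (hlam j) (N.dist_rpow_pos (hne j))
  have hX := hA.measurable_normSq (rx := fun _ => none) (tx := id) hne
  have hind := hA.iIndepFun_normSq (rx := fun _ => none) (tx := id) hne
    fun i j h => congrArg Prod.snd h
  have hlaw := hA.map_normSq (rx := fun _ => none) (tx := id) hne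
  have hR := two_rpow_sub_one_pos N.rate_pos
  have hlead : simplexVolume N.transmitters.card ((2 ^ N.rate - 1) / P) *
      ∏ j ∈ N.transmitters, (lam j / N.dist none j ^ N.pathLoss)⁻¹ =
        N.mimoLeadingTerm lam P := by
    rw [simplexVolume, if_pos (div_pos hR hP), card_transmitters, mimoLeadingTerm, div_pow,
      div_div, mul_comm (P ^ _)]
    simp only [inv_div]
  have hlead0 : 0 ≤ N.mimoLeadingTerm lam P := by
    rw [← hlead]
    exact mul_nonneg (simplexVolume_nonneg _ _)
      (Finset.prod_nonneg fun j _ => (inv_pos.2 (hc j)).le)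
  rw [N.mimoOutage_eq hP hlam]
  constructor
  · have h := le_measure_weightedSum_lt hX hind hlaw hc N.transmitters ((2 ^ N.rate - 1) / P)
    rw [hlead] at h
    simp only [inv_div] at h
    exact (ENNReal.ofReal_le_iff_le_toReal (measure_ne_top _ _)).1 h
  · have h := measure_weightedSum_lt_le hX hind hlaw hc N.transmitters ((2 ^ N.rate - 1) / P)
    rw [hlead] at h
    exact ENNReal.toReal_le_of_le_ofReal hlead0 h

/-- The leading term of the MIMO outage probability is this constant over `P ^ N.hops`. -/
def mimoCoeff (lam : Fin K → ℝ) : ℝ :=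
  ((2 : ℝ) ^ N.rate - 1) ^ N.hops / N.hops.factorial *
    ∏ j ∈ N.transmitters, N.dist none j ^ N.pathLoss / lam j

lemma mimoCoeff_pos (hlam : ∀ j, 0 < lam j) : 0 < N.mimoCoeff lam := by
  have hR := two_rpow_sub_one_pos N.rate_pos
  have : 0 < ∏ j ∈ N.transmitters, N.dist none j ^ N.pathLoss / lam j :=
    Finset.prod_pos fun j _ => div_pos (N.dist_rpow_pos (by simp)) (hlam j)
  unfold mimoCoeff
  positivity

lemma mimoLeadingTerm_eq (P : ℝ) :
    N.mimoLeadingTerm lam P = N.mimoCoeff lam / P ^ N.hops := by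
  rw [mimoLeadingTerm, mimoCoeff, ← div_div]
  ring

/-- The two simplex bounds differ by the factor `exp (-x)` with `x` of order `1 / P`, and `1 - exp
(-x) ≤ x`. -/
theorem abs_mimoOutage_sub_le (hlam : ∀ j, 0 < lam j) (hA : IsIIDComplexGaussianFading A μ)
    {P : ℝ} (hP : 0 < P) :
    |N.mimoOutage μ A (fun j => lam j * P) - N.mimoLeadingTerm lam P| ≤
      N.mimoCoeff lam * ((2 ^ N.rate - 1) *
        ∑ j ∈ N.transmitters, N.dist none j ^ N.pathLoss / lam j) / P ^ (N.hops + 1) := by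
  obtain ⟨h1, h2⟩ := N.mimoOutage_bounds hlam hA hP
  set S := ∑ j ∈ N.transmitters, N.dist none j ^ N.pathLoss / lam j
  rw [abs_of_nonpos (sub_nonpos.2 h2), neg_sub, sub_le_comm]
  refine le_trans ?_ h1
  have hlead0 : 0 ≤ N.mimoLeadingTerm lam P := by
    rw [mimoLeadingTerm_eq]
    exact div_nonneg (N.mimoCoeff_pos hlam).le (by positivity)
  have hexp := Real.add_one_le_exp (-((2 ^ N.rate - 1) / P * S))
  refine le_trans (le_of_eq ?_) (mul_le_mul_of_nonneg_left hexp hlead0)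
  rw [mimoLeadingTerm_eq]
  field_simp
  ring

theorem mimoOutage_le_ddfOutage (hlam : ∀ j, 0 < lam j) {P : ℝ} (hP : 0 < P) :
    N.mimoOutage μ A (fun j => lam j * P) ≤ N.ddfOutage μ A (fun j => lam j * P) :=
  measureReal_mono fun _ hω => (N.ddfInfo_le _ fun j => (mul_pos (hlam j) hP).le).trans_lt hω

/-! ### Weak links -/

/-- The event that all links from `S` to the destination and to the transmitters outside `S` are
weak. -/
def weakLinks (lam : Fin K → ℝ) (A : Option (Fin K) → Fin K → Ω → ℂ) (P ε : ℝ)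
    (S : Finset (Fin K)) : Set Ω :=
  {ω | ∀ j ∈ S, ‖N.fadingGain (fun m j => A m j ω) none j‖ ^ 2 * (lam j * P) < ε ∧
    ∀ i ∈ N.transmitters \ S,
      ‖N.fadingGain (fun m j => A m j ω) (some i) j‖ ^ 2 * (lam j * P) < ε}

lemma measureReal_weakLinks_le (hlam : ∀ j, 0 < lam j) (hA : IsIIDComplexGaussianFading A μ)
    {P ε : ℝ} (hP : 0 < P) (hε : 0 ≤ ε) (S : Finset (Fin K)) :
    μ.real (N.weakLinks lam A P ε S) ≤
      ∏ j ∈ S, (ε * N.dist none j ^ N.pathLoss / (lam j * P) *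
        ∏ i ∈ N.transmitters \ S, ε * N.dist (some i) j ^ N.pathLoss / (lam j * P)) := by
  -- The links are indexed by a transmitter in `S` and a receiver, `none` being the destination;
  -- distinct indices give distinct links, hence independence.
  let rx : ↥S × Option ↥(N.transmitters \ S) → Option (Fin K) := fun e => e.2.map Subtype.val
  let tx : ↥S × Option ↥(N.transmitters \ S) → Fin K := fun e => e.1
  have hne : ∀ e, rx e ≠ some (tx e) := by
    rintro ⟨j, _ | i⟩ h
    · simp [rx] at h
    · have h' : (i : Fin K) = j := by simpa [rx, tx] using h
      exact (Finset.mem_sdiff.1 i.2).2 (h' ▸ j.2)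
  have hinj : Function.Injective fun e => (rx e, tx e) := by
    rintro ⟨j, i⟩ ⟨j', i'⟩ h
    simp only [Prod.mk.injEq, rx, tx] at h
    exact Prod.ext (Subtype.ext h.2) (Option.map_injective Subtype.val_injective h.1)
  let b : ↥S × Option ↥(N.transmitters \ S) → ℝ := fun e =>
    ε * N.dist (rx e) (tx e) ^ N.pathLoss / (lam (tx e) * P)
  have hb : ∀ e, 0 ≤ b e := fun e =>
    div_nonneg (mul_nonneg hε (N.dist_rpow_pos (hne e)).le) (mul_pos (hlam _) hP).le
  have hmain := measure_forall_lt_le (hA.measurable_normSq hne) (hA.iIndepFun_normSq hne hinj)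
    (hA.map_normSq hne) hb Finset.univ
  have hprod : ∏ e, b e = ∏ j ∈ S, (ε * N.dist none j ^ N.pathLoss / (lam j * P) *
        ∏ i ∈ N.transmitters \ S, ε * N.dist (some i) j ^ N.pathLoss / (lam j * P)) := by
    rw [Fintype.prod_prod_type, ← Finset.prod_coe_sort S]
    refine Finset.prod_congr rfl fun j _ => ?_
    rw [Fintype.prod_option, ← Finset.prod_coe_sort (N.transmitters \ S)]
    rfl
  rw [← hprod]
  refine (measureReal_mono ?_).trans (ENNReal.toReal_le_of_le_ofReal
    (Finset.prod_nonneg fun e _ => hb e) hmain)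
  intro ω hω e _
  have hgain : ‖N.fadingGain (fun m j => A m j ω) (rx e) (tx e)‖ ^ 2 * (lam (tx e) * P) < ε := by
    obtain ⟨j, _ | i⟩ := e
    · exact (hω j j.2).1
    · exact (hω j j.2).2 i i.2
  rw [norm_fadingGain_sq _ _ (hne e), div_mul_eq_mul_div,
    div_lt_iff₀ (N.dist_rpow_pos (hne e))] at hgain
  rwa [lt_div_iff₀ (mul_pos (hlam _) hP)]

/-- The source alone has exactly `N.hops` outgoing links (destination and cooperating users), so
this event is of leading order. -/
lemma measureReal_weakLinks_source_le (hlam : ∀ j, 0 < lam j) (hsource : lam N.source = 1)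
    (hA : IsIIDComplexGaussianFading A μ) {P : ℝ} (hP : 0 < P) {θ : ℕ → ℝ} (hθ : 0 < θ 0) :
    μ.real (N.weakLinks lam A P (2 ^ (N.rate / θ 0) - 1) {N.source}) ≤
      N.mimoLeadingTerm lam P * N.constD lam θ := by
  have hε := two_rpow_sub_one_pos (div_pos N.rate_pos hθ)
  have hR := two_rpow_sub_one_pos N.rate_pos
  refine (N.measureReal_weakLinks_le hlam hA hP hε.le _).trans_eq ?_
  have hsdiff : N.transmitters \ {N.source} = N.coop := by
    rw [transmitters, Finset.sdiff_singleton_eq_erase, Finset.erase_insert N.source_notMem]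
  have hne : ∀ j ∈ N.coop, N.dist none j ^ N.pathLoss / lam j ≠ 0 := fun j _ =>
    (div_pos (N.dist_rpow_pos (by simp)) (hlam j)).ne'
  have hprod0 := Finset.prod_ne_zero_iff.2 hne
  have hfac : (N.hops.factorial : ℝ) ≠ 0 := by positivity
  rw [Finset.prod_singleton, hsdiff, mimoLeadingTerm, constD, transmitters,
    Finset.prod_insert N.source_notMem, Finset.prod_div_distrib (s := N.coop)
      (f := fun j => N.dist (some j) N.source ^ N.pathLoss), hsource]
  simp only [one_mul, mul_div_right_comm _ _ P]
  rw [Finset.prod_mul_distrib, Finset.prod_const, hops, div_one, div_pow]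
  rw [hops] at hfac
  field_simp
  ring

lemma exists_measureReal_weakLinks_le (hlam : ∀ j, 0 < lam j)
    (hA : IsIIDComplexGaussianFading A μ) {ε : ℝ} (hε : 0 ≤ ε) {S : Finset (Fin K)}
    (hS : S ⊆ N.transmitters) (h2 : 2 ≤ S.card) (hlt : S.card < N.hops) :
    ∃ M : ℝ, 0 ≤ M ∧ ∀ P : ℝ, 1 ≤ P →
      μ.real (N.weakLinks lam A P ε S) ≤ M / P ^ (N.hops + 1) := by
  refine ⟨∏ j ∈ S, (ε * N.dist none j ^ N.pathLoss / lam j *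
        ∏ i ∈ N.transmitters \ S, ε * N.dist (some i) j ^ N.pathLoss / lam j), ?_, ?_⟩
  · refine Finset.prod_nonneg fun j hj => mul_nonneg
      (div_nonneg (mul_nonneg hε (N.dist_rpow_pos (by simp)).le) (hlam j).le)
      (Finset.prod_nonneg fun i hi => div_nonneg (mul_nonneg hε (N.dist_rpow_pos ?_).le)
        (hlam j).le)
    rintro h
    exact (Finset.mem_sdiff.1 hi).2 (Option.some_injective _ h ▸ hj)
  · intro P hP
    have hP0 : 0 < P := one_pos.trans_le hP
    refine (N.measureReal_weakLinks_le hlam hA hP0 hε S).trans ?_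
    simp only [← div_div _ _ P]
    simp only [Finset.prod_div_distrib (g := fun _ => P), Finset.prod_const, div_mul_div_comm,
      ← pow_succ']
    rw [Finset.prod_div_distrib, Finset.prod_const, ← pow_mul,
      Finset.card_sdiff_of_subset hS, card_transmitters]
    refine div_le_div_of_nonneg_left ?_ (by positivity) (pow_le_pow_right₀ hP ?_)
    · refine Finset.prod_nonneg fun j hj => mul_nonneg
        (div_nonneg (mul_nonneg hε (N.dist_rpow_pos (by simp)).le) (hlam j).le)
        (Finset.prod_nonneg fun i hi => div_nonneg (mul_nonneg hε (N.dist_rpow_pos ?_).le)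
          (hlam j).le)
      rintro h
      exact (Finset.mem_sdiff.1 hi).2 (Option.some_injective _ h ▸ hj)
    -- With `k = S.card` and `L = N.hops`, the exponent is `k (L + 1 - k) = L + (k - 1) (L - k)`,
    -- which is at least `L + 1` when `2 ≤ k < L`.
    · obtain ⟨s, hs⟩ := Nat.exists_eq_add_of_le h2
      obtain ⟨r, hr⟩ := Nat.exists_eq_add_of_lt hlt
      rw [hr, hs, show 2 + s + r + 1 - (2 + s) + 1 = r + 2 by omega]
      nlinarith [Nat.zero_le (s * r)]

/-! ### All slots but the last one are short -/

/-- The event that the destination gains, weighted by the transmission times that belong to the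
reference fractions, are small. -/
def weakSum (lam : Fin K → ℝ) (A : Option (Fin K) → Fin K → Ω → ℂ) (θ : ℕ → ℝ) (P : ℝ)
    (σ : Fin N.hops → Fin K) : Set Ω :=
  {ω | ∑ l, ‖N.fadingGain (fun m j => A m j ω) none (σ l)‖ ^ 2 *
      (lam (σ l) * P / (1 - ∑ i ∈ Finset.range l, θ i)) < 2 ^ (N.rate / θ (N.hops - 1)) - 1}

lemma one_sub_sum_pos {θ : ℕ → ℝ} (hθ : ∀ l < N.hops, 0 < θ l)
    (hsum : ∑ l ∈ Finset.range N.hops, θ l = 1) {l : ℕ} (hl : l < N.hops) :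
    0 < 1 - ∑ i ∈ Finset.range l, θ i := by
  rw [← hsum, ← Finset.sum_Ico_eq_sub _ hl.le]
  exact Finset.sum_pos (fun i hi => hθ i (Finset.mem_Ico.1 hi).2) (Finset.nonempty_Ico.2 hl)

/-- The simplex bound sees the weights only through their product, so the result does not depend on
the enumeration `σ`. -/
lemma measure_weakSum_le (hlam : ∀ j, 0 < lam j) (hA : IsIIDComplexGaussianFading A μ)
    {θ : ℕ → ℝ} (hθ : ∀ l < N.hops, 0 < θ l) (hsum : ∑ l ∈ Finset.range N.hops, θ l = 1)
    {P : ℝ} (hP : 0 < P) {σ : Fin N.hops → Fin K} (hinj : Function.Injective σ)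
    (himage : Finset.univ.image σ = N.transmitters) :
    μ (N.weakSum lam A θ P σ) ≤ ENNReal.ofReal (N.mimoLeadingTerm lam P * N.constC θ) := by
  have hne : ∀ l : Fin N.hops, (none : Option (Fin K)) ≠ some (σ l) := by simp
  have hbar : ∀ l : Fin N.hops, 0 < 1 - ∑ i ∈ Finset.range (l : ℕ), θ i := fun l =>
    N.one_sub_sum_pos hθ hsum l.2
  have hR := two_rpow_sub_one_pos N.rate_pos
  have hε := two_rpow_sub_one_pos
    (div_pos N.rate_pos (hθ (N.hops - 1) (Nat.sub_lt N.hops_pos one_pos)))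
  set ε : ℝ := 2 ^ (N.rate / θ (N.hops - 1)) - 1 with hεdef
  have h := measure_weightedSum_lt_le (hA.measurable_normSq (rx := fun _ => none) hne)
    (hA.iIndepFun_normSq (rx := fun _ => none) hne fun i j h => hinj (congrArg Prod.snd h))
    (hA.map_normSq (rx := fun _ => none) hne)
    (c := fun l => lam (σ l) / N.dist none (σ l) ^ N.pathLoss /
      (1 - ∑ i ∈ Finset.range (l : ℕ), θ i))
    (fun l => div_pos (div_pos (hlam _) (N.dist_rpow_pos (hne l))) (hbar l)) Finset.univ (ε / P)
  have hset : N.weakSum lam A θ P σ = {ω | ∑ l : Fin N.hops,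
      lam (σ l) / N.dist none (σ l) ^ N.pathLoss / (1 - ∑ i ∈ Finset.range (l : ℕ), θ i) *
        ‖A none (σ l) ω‖ ^ 2 < ε / P} := by
    ext ω
    rw [weakSum, Set.mem_ofPred_eq, Set.mem_ofPred_eq, lt_div_iff₀ hP, Finset.sum_mul]
    refine iff_of_eq (congrArg (· < _) (Finset.sum_congr rfl fun l _ => ?_))
    rw [norm_fadingGain_sq _ _ (by simp)]
    ring
  rw [hset]
  refine h.trans_eq (congrArg ENNReal.ofReal ?_)
  have hprod : ∏ l : Fin N.hops, N.dist none (σ l) ^ N.pathLoss / lam (σ l) =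
      ∏ j ∈ N.transmitters, N.dist none j ^ N.pathLoss / lam j := by
    rw [← himage, Finset.prod_image hinj.injOn]
  rw [simplexVolume, if_pos (div_pos hε hP), Finset.card_univ, Fintype.card_fin, div_pow,
    mimoLeadingTerm, constC, ← hεdef, ← hprod,
    ← Fin.prod_univ_eq_prod_range (fun j => 1 - ∑ i ∈ Finset.range j, θ i)]
  simp only [inv_div, div_div_eq_mul_div, mul_div_assoc, Finset.prod_mul_distrib]
  have hfac : (N.hops.factorial : ℝ) ≠ 0 := by positivity
  field_simp

/-- Only destination links are assumed measurable, for an arbitrary σ-algebra on `Ω`, so that the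
lemma applies to the one generated by these links. `measurableSet_order_eq` plays the same role for
inter-user links. -/
lemma measurableSet_weakSum {Ω : Type*} [MeasurableSpace Ω] {A : Option (Fin K) → Fin K → Ω → ℂ}
    (hA : ∀ j, Measurable (A none j)) (θ : ℕ → ℝ) (P : ℝ) (σ : Fin N.hops → Fin K) :
    MeasurableSet (N.weakSum lam A θ P σ) := by
  unfold weakSum fadingGain
  exact measurableSet_lt (by fun_prop) (by fun_prop)

lemma measurableSet_order_eq {Ω : Type*} [MeasurableSpace Ω]
    {A : Option (Fin K) → Fin K → Ω → ℂ} (hA : ∀ i j, i ≠ j → Measurable (A (some i) j))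
    (pw : Fin K → ℝ) {n : ℕ} (σ : Fin n → Fin K) :
    MeasurableSet ((fun ω (l : Fin n) => N.order pw (fun m j => A m j ω) l) ⁻¹' {σ}) :=
  (measurable_pi_lambda _ fun l : Fin n => N.measurable_order pw hA l) (measurableSet_singleton σ)

lemma measure_order_inter_weakSum {Ω : Type*} [mΩ : MeasurableSpace Ω] {μ : Measure Ω}
    {A : Option (Fin K) → Fin K → Ω → ℂ} (hA : IsIIDComplexGaussianFading A μ)
    (θ : ℕ → ℝ) (P : ℝ) (σ : Fin N.hops → Fin K) :
    μ ((fun ω (l : Fin N.hops) => N.order (fun j => lam j * P) (fun m j => A m j ω) l) ⁻¹' {σ} ∩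
        N.weakSum lam A θ P σ) =
      μ ((fun ω (l : Fin N.hops) => N.order (fun j => lam j * P) (fun m j => A m j ω) l) ⁻¹' {σ}) *
        μ (N.weakSum lam A θ P σ) := by
  obtain ⟨mU, mD, hindep, hU, hD⟩ := hA.exists_indep
  exact (@Indep_iff _ mU mD mΩ μ).1 hindep _ _ (@measurableSet_order_eq _ N _ mU _ hU _ _ σ)
    (@measurableSet_weakSum _ N _ _ mD _ hD θ P σ)

lemma measure_weakSum_order_le (hlam : ∀ j, 0 < lam j) (hA : IsIIDComplexGaussianFading A μ)
    {θ : ℕ → ℝ} (hθ : ∀ l < N.hops, 0 < θ l) (hsum : ∑ l ∈ Finset.range N.hops, θ l = 1)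
    {P : ℝ} (hP : 0 < P) :
    μ {ω | ω ∈ N.weakSum lam A θ P
      fun l => N.order (fun j => lam j * P) (fun m j => A m j ω) l} ≤
      ENNReal.ofReal (N.mimoLeadingTerm lam P * N.constC θ) := by
  refine measure_setOf_mem_le (π := fun ω (l : Fin N.hops) =>
    N.order (fun j => lam j * P) (fun m j => A m j ω) l) (measurable_pi_lambda _ fun l =>
      N.measurable_order _ (fun i j hij => hA.measurable _ _ fun h => hij (Option.some.inj h)) l)
    (B := N.weakSum lam A θ P) fun ω => ?_
  rw [N.measure_order_inter_weakSum hA θ P]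
  refine mul_le_mul_right (N.measure_weakSum_le hlam hA hθ hsum hP ?_ ?_) _
  · intro i j hij
    exact Fin.ext (N.injOn_order _ _ (by simp) (by simp) hij)
  · rw [← N.image_order (fun j => lam j * P) (fun m j => A m j ω)]
    ext j
    simp only [Finset.mem_image, Finset.mem_univ, true_and, Finset.mem_range]
    exact ⟨fun ⟨l, hl⟩ => ⟨l, l.2, hl⟩, fun ⟨l, h, hl⟩ => ⟨⟨l, h⟩, hl⟩⟩

/-! ### The upper bound -/

theorem exists_ddfOutage_le (hlam : ∀ j, 0 < lam j) (hsource : lam N.source = 1)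
    (hA : IsIIDComplexGaussianFading A μ) {θ : ℕ → ℝ} (hθ : ∀ l < N.hops, 0 < θ l)
    (hsum : ∑ l ∈ Finset.range N.hops, θ l = 1) :
    ∃ M : ℝ, 0 < M ∧ ∀ P : ℝ, 1 ≤ P →
      N.ddfOutage μ A (fun j => lam j * P) ≤
        N.mimoLeadingTerm lam P * (N.constC θ + N.constD lam θ) + M / P ^ (N.hops + 1) := by
  classical
  -- The possible active sets of the slots strictly between the first and the last; a set `S` is
  -- active in slot `S.card - 1`, slots being numbered from 0.
  let T := N.transmitters.powerset.filter fun S => 2 ≤ S.card ∧ S.card < N.hops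
  let ε : ℕ → ℝ := fun l => 2 ^ (N.rate / θ l) - 1
  have hM : ∀ S : Finset (Fin K), ∃ M : ℝ, 0 ≤ M ∧ ∀ P : ℝ, 1 ≤ P → S ∈ T →
      μ.real (N.weakLinks lam A P (ε (S.card - 1)) S) ≤ M / P ^ (N.hops + 1) := by
    intro S
    by_cases hS : S ∈ T
    · obtain ⟨h1, h2, h3⟩ := Finset.mem_filter.1 hS
      have hε := two_rpow_sub_one_pos (div_pos N.rate_pos (hθ (S.card - 1) (by omega)))
      obtain ⟨M, hM, h⟩ := N.exists_measureReal_weakLinks_le hlam hA hε.le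
        (Finset.mem_powerset.1 h1) h2 h3
      exact ⟨M, hM, fun P hP _ => h P hP⟩
    · exact ⟨0, le_rfl, fun _ _ h => absurd h hS⟩
  choose M hM0 hM using hM
  -- The added 1 keeps the constant positive even when `T` is empty.
  refine ⟨∑ S ∈ T, M S + 1, add_pos_of_nonneg_of_pos (Finset.sum_nonneg fun S _ => hM0 S) one_pos,
    fun P hP => ?_⟩
  have hP0 : 0 < P := one_pos.trans_le hP
  have hpw : ∀ j, 0 ≤ lam j * P := fun j => (mul_pos (hlam j) hP0).le
  have hC : μ.real {ω | ω ∈ N.weakSum lam A θ P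
      fun l => N.order (fun j => lam j * P) (fun m j => A m j ω) l} ≤
        N.mimoLeadingTerm lam P * N.constC θ := by
    refine ENNReal.toReal_le_of_le_ofReal ?_ (N.measure_weakSum_order_le hlam hA hθ hsum hP0)
    rw [mimoLeadingTerm_eq, constC]
    have h1 := N.mimoCoeff_pos hlam
    have h2 := two_rpow_sub_one_pos N.rate_pos
    have h3 := two_rpow_sub_one_pos
      (div_pos N.rate_pos (hθ (N.hops - 1) (Nat.sub_lt N.hops_pos one_pos)))
    have h4 : 0 ≤ ∏ j ∈ Finset.range N.hops, (1 - ∑ i ∈ Finset.range j, θ i) :=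
      Finset.prod_nonneg fun j hj => (N.one_sub_sum_pos hθ hsum (Finset.mem_range.1 hj)).le
    positivity
  have hD := N.measureReal_weakLinks_source_le hlam hsource hA hP0 (hθ 0 N.hops_pos)
  have hsub : {ω | N.ddfInfo (fun j => lam j * P) (fun m j => A m j ω) < N.rate} ⊆
      ({ω | ω ∈ N.weakSum lam A θ P
        fun l => N.order (fun j => lam j * P) (fun m j => A m j ω) l} ∪
      N.weakLinks lam A P (ε 0) {N.source}) ∪
      ⋃ S ∈ T, N.weakLinks lam A P (ε (S.card - 1)) S := by
    intro ω hω
    by_cases hle : ∀ l < N.hops - 1,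
        N.fraction (fun j => lam j * P) (fun m j => A m j ω) l ≤ θ l
    · refine Or.inl (Or.inl ?_)
      have h := N.weightedSum_lt_of_fraction_le _ hpw hω hθ hsum hle
      rw [← Fin.sum_univ_eq_sum_range (fun l =>
        ‖N.fadingGain (fun m j => A m j ω) none
          (N.order (fun j => lam j * P) (fun m j => A m j ω) l)‖ ^ 2 *
        (lam (N.order (fun j => lam j * P) (fun m j => A m j ω) l) * P /
          (1 - ∑ i ∈ Finset.range l, θ i)))] at h
      exact h
    · push Not at hle
      obtain ⟨l, hl, hlt⟩ := hle
      have hl' : l < N.hops := by omega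
      have hmem : ω ∈ N.weakLinks lam A P (ε l)
          (N.activeUsers (fun j => lam j * P) (fun m j => A m j ω) l) := fun j hj =>
        N.weak_links_of_lt_fraction _ hpw hω hl' (hθ l hl') hlt hj
      obtain ⟨hS1, hS2⟩ := N.activeUsers_spec (fun j => lam j * P) (fun m j => A m j ω) l hl'
      rcases l.eq_zero_or_pos with rfl | hpos
      · exact Or.inl (Or.inr hmem)
      · refine Or.inr (Set.mem_biUnion (Finset.mem_filter.2
          ⟨Finset.mem_powerset.2 hS1, ?_, ?_⟩ : _ ∈ T) ?_)
        · omega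
        · omega
        · rwa [hS2, Nat.add_sub_cancel]
  calc _ ≤ _ := measureReal_mono hsub
    _ ≤ (_ + _) + ∑ S ∈ T, μ.real (N.weakLinks lam A P (ε (S.card - 1)) S) :=
        (measureReal_union_le _ _).trans
          (add_le_add (measureReal_union_le _ _) (measureReal_biUnion_finset_le _ _))
    _ ≤ (N.mimoLeadingTerm lam P * N.constC θ + N.mimoLeadingTerm lam P * N.constD lam θ) +
          ∑ S ∈ T, M S / P ^ (N.hops + 1) :=
        add_le_add (add_le_add hC hD) (Finset.sum_le_sum fun S hS => hM S P hP hS)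
    _ ≤ _ := by
        rw [← Finset.sum_div, mul_add]
        gcongr
        linarith

end UserCoopNetwork

/-! ### Diversity -/

lemma tendsto_neg_log_div_log {f : ℝ → ℝ} {n : ℕ} {c C : ℝ} (hc : 0 < c)
    (hlow : ∀ᶠ P in atTop, c / P ^ n ≤ f P) (hup : ∀ᶠ P in atTop, f P ≤ C / P ^ n) :
    Tendsto (fun P => -Real.log (f P) / Real.log P) atTop (𝓝 n) := by
  have hlim : ∀ b : ℝ, Tendsto (fun P => (n : ℝ) - b / Real.log P) atTop (𝓝 n) := fun b => by
    simpa using tendsto_const_nhds.sub (Real.tendsto_log_atTop.const_div_atTop b)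
  refine tendsto_of_tendsto_of_tendsto_of_le_of_le' (hlim (Real.log C)) (hlim (Real.log c)) ?_ ?_
  · filter_upwards [hlow, hup, eventually_gt_atTop 1] with P h1 h2 hP
    have hP0 : 0 < P := one_pos.trans hP
    have hlog := Real.log_pos hP
    have hf : 0 < f P := (div_pos hc (pow_pos hP0 n)).trans_le h1
    -- Forced by the positive lower bound on `f`, so it need not be assumed.
    have hC : 0 < C := by
      have := hf.trans_le h2
      rwa [div_pos_iff_of_pos_right (pow_pos hP0 n)] at this
    have h := Real.log_le_log hf h2
    rw [Real.log_div hC.ne' (pow_pos hP0 n).ne', Real.log_pow] at h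
    rw [le_div_iff₀ hlog, sub_mul, div_mul_cancel₀ _ hlog.ne']
    linarith
  · filter_upwards [hlow, eventually_gt_atTop 1] with P h1 hP
    have hP0 : 0 < P := one_pos.trans hP
    have hlog := Real.log_pos hP
    have h := Real.log_le_log (div_pos hc (pow_pos hP0 n)) h1
    rw [Real.log_div hc.ne' (pow_pos hP0 n).ne', Real.log_pow] at h
    rw [div_le_iff₀ hlog, sub_mul, div_mul_cancel₀ _ hlog.ne']
    linarith

namespace UserCoopNetwork

variable {K : ℕ} (N : UserCoopNetwork K) {lam : Fin K → ℝ}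
  {Ω : Type*} [MeasurableSpace Ω] {μ : Measure Ω} [IsProbabilityMeasure μ]
  {A : Option (Fin K) → Fin K → Ω → ℂ}

theorem tendsto_diversity (hlam : ∀ j, 0 < lam j) (hsource : lam N.source = 1)
    (hA : IsIIDComplexGaussianFading A μ) :
    Tendsto (fun P : ℝ => -Real.log (N.ddfOutage μ A (fun j => lam j * P)) / Real.log P)
      atTop (𝓝 (N.hops : ℝ)) := by
  have hhops : (0 : ℝ) < N.hops := Nat.cast_pos.2 N.hops_pos
  -- Any admissible reference fractions would do, since only the exponent of `P` matters; equal ones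
  -- are simplest.
  let θ : ℕ → ℝ := fun _ => 1 / N.hops
  obtain ⟨M, hM, hup⟩ := N.exists_ddfOutage_le hlam hsource hA (θ := θ)
    (fun _ _ => one_div_pos.2 hhops) (by simp [θ, hhops.ne'])
  set B := ∑ j ∈ N.transmitters, N.dist none j ^ N.pathLoss / lam j with hB
  have hcoeff := N.mimoCoeff_pos hlam
  refine tendsto_neg_log_div_log (c := N.mimoCoeff lam * Real.exp (-((2 ^ N.rate - 1) * B)))
    (C := N.mimoCoeff lam * (N.constC θ + N.constD lam θ) + M) (by positivity) ?_ ?_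
  · filter_upwards [eventually_ge_atTop 1] with P hP
    have hP0 : 0 < P := one_pos.trans_le hP
    have hB0 : 0 ≤ B := Finset.sum_nonneg fun j _ =>
      (div_pos (N.dist_rpow_pos (by simp)) (hlam j)).le
    have hR := two_rpow_sub_one_pos N.rate_pos
    refine le_trans ?_ ((N.mimoOutage_bounds hlam hA hP0).1.trans
      (N.mimoOutage_le_ddfOutage hlam hP0))
    rw [mimoLeadingTerm_eq, mul_div_right_comm, ← hB]
    gcongr
    exact div_le_self hR.le hP
  · filter_upwards [eventually_ge_atTop 1] with P hP
    have hP0 : 0 < P := one_pos.trans_le hP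
    refine (hup P hP).trans ?_
    rw [mimoLeadingTerm_eq, add_div, mul_div_right_comm]
    gcongr
    exact Nat.le_succ _

end UserCoopNetwork
end

theorem mainTheorem3 {K : ℕ} (N : UserCoopNetwork K)
    (lam : Fin K → ℝ) (hlam : ∀ j, 0 < lam j) (hsource : lam N.source = 1)
    {Ω : Type*} [MeasurableSpace Ω] (μ : Measure Ω) [IsProbabilityMeasure μ]
    (A : Option (Fin K) → Fin K → Ω → ℂ) (hA : IsIIDComplexGaussianFading A μ) :
    -- the MIMO outage probability is a lower bound, with its high-power expansion
    (∀ P : ℝ, 0 < P →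
      N.mimoOutage μ A (fun j => lam j * P) ≤ N.ddfOutage μ A (fun j => lam j * P)) ∧
    (∃ M : ℝ, 0 < M ∧ ∃ P₀ : ℝ, 0 < P₀ ∧ ∀ P : ℝ, P₀ ≤ P →
      |N.mimoOutage μ A (fun j => lam j * P) - N.mimoLeadingTerm lam P| ≤
        M / P ^ (N.hops + 1)) ∧
    -- the upper bound, for all admissible reference fractions
    (∀ θ : ℕ → ℝ, (∀ l < N.hops, 0 < θ l) → ∑ l ∈ Finset.range N.hops, θ l = 1 →
      ∃ M : ℝ, 0 < M ∧ ∃ P₀ : ℝ, 0 < P₀ ∧ ∀ P : ℝ, P₀ ≤ P →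
        N.ddfOutage μ A (fun j => lam j * P) ≤
          N.mimoLeadingTerm lam P * (N.constC θ + N.constD lam θ) + M / P ^ (N.hops + 1)) ∧
    -- the diversity order is the number of hops
    Tendsto (fun P : ℝ => -Real.log (N.ddfOutage μ A (fun j => lam j * P)) / Real.log P)
      atTop (𝓝 (N.hops : ℝ)) := by
  refine ⟨fun P hP => N.mimoOutage_le_ddfOutage hlam hP, ⟨_, ?_, 1, one_pos, fun P hP =>
    N.abs_mimoOutage_sub_le hlam hA (one_pos.trans_le hP)⟩, fun θ hθ hsum => ?_,
    N.tendsto_diversity hlam hsource hA⟩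
  · refine mul_pos (N.mimoCoeff_pos hlam) (mul_pos
      (UserCoopNetwork.two_rpow_sub_one_pos N.rate_pos) (Finset.sum_pos (fun j _ =>
        div_pos (N.dist_rpow_pos (by simp)) (hlam j)) (Finset.insert_nonempty _ _)))
  · obtain ⟨M, hM, h⟩ := N.exists_ddfOutage_le hlam hsource hA hθ hsum
    exact ⟨M, hM, 1, one_pos, h⟩
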